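/- Let $n\ge 1$ and let $\lambda=(\lambda_1\ge\lambda_2\ge\cdots\ge\lambda_n>0)$ be integers, $|\lambda|=\sum_i\lambda_i$. For a prime $p$ let $G_\lambda=\mathbb Z/p^{\lambda_1}\mathbb Z\oplus\cdots\oplus\mathbb Z/p^{\lambda_n}\mathbb Z$. For $0\le\ell\le n$ put $c_\ell(\lambda)=\lambda_{\ell+1}+\lambda_{\ell+3}+\lambda_{\ell+5}+\cdots$ (sum over indices $\le n$; so $c_n(\lambda)=0$), $ev_\lambda=c_1(\lambda)$, $od_\lambda=c_0(\lambda)=|\lambda|-ev_\lambda$. For $0\le\ell\le n-1$ put $a_\ell(\lambda)=\sum_{i=\ell+2}^n\lfloor (i-\ell)/2\rfloor\lambda_i$ and $\lambda^{(\ell)}=(\lambda_{\ell+1},\dots,\lambda_n)$, and write $\lambda'=\lambda^{(1)}$ when $n\ge2$. Consider the integer intervals $J_\ell(\lambda)=[c_{\ell+1}(\lambda),c_\ell(\lambda)]$ for $0\le\ell\le n-1$ (so $J_0(\lambda)=[ev_\lambda,od_\lambda]$) and $J_{-\ell}(\lambda)=[|\lambda|-c_\ell(\lambda),\,|\lambda|-c_{\ell+1}(\lambda)]$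 for $1\le\ell\le n-1$. Then $J_\ell(\lambda)=J_0(\lambda^{(\ell)})$ for $1\le\ell\le n-1$. **Coefficients.** There are well-defined natural numbers $C(n,\lambda;k)$, $0\le k\le|\lambda|$, determined by the following rules: $C(n,\lambda;k)=1$ if $n\le 2$; $C(n,\lambda;|\lambda|-k)=C(n,\lambda;k)$; and $$C(n,\lambda;k)=\begin{cases} C(n-\ell,\lambda^{(\ell)};k) & \text{if } k\in J_\ell(\lambda),\ 1\le\ell\le n-1,\\[1mm] \displaystyle\sum_{i=\max\{ev_\lambda,\;k-\lambda_1+\lambda_2\}}^{\min\{k,\;od_\lambda-\lambda_1+\lambda_2\}} C(n-1,\lambda';i) & \text{if } n\ge 2,\ k\in J_0(\lambda).\end{cases}$$ **Theorem.** For each integer $k\ge0$ there is a polynomial $N_k(\lambda)$ with integer coefficients whose value at every prime $p$ is the number of subgroups of order $p^k$ of $G_\lambda$. Its highest term as a polynomial in $p$ is $$C(n,\lambda;k)\,p^{\ell k+a_\ell(\lambda)}\qquad\text{if } k\in J_\ell(\lambda),\ 0\le\ell\le n-1.$$ If $|\lambda|/2\le k\le|\lambda|$, the highest term of $N_k(\lambda)$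 equals that of $N_{|\lambda|-k}(\lambda)$; explicitly it is $C(n,\lambda;|\lambda|-k)\,p^{\ell(|\lambda|-k)+a_\ell(\lambda)}$ if $k\in J_{-\ell}(\lambda)$, $1\le\ell\le n-1$. Further, for each $0\le\ell\le n-1$ the sequence $C(n,\lambda;k)$, $k\in J_\ell(\lambda)$, is unimodal and symmetric with respect to $|\lambda^{(\ell)}|/2$, and $C(n,\lambda;c_\ell(\lambda))=1$ for all $0\le\ell\le n$. In particular $$H_n(\lambda):=\max_{0\le k\le|\lambda|}\deg N_k(\lambda)=a_0(\lambda)=\sum_{i=2}^n\lfloor i/2\rfloor\lambda_i .$$ -/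

import Mathlib

open Finset Polynomial

/-- `part lam i` is the `i`-th part `λ_i` of `λ = (λ_1, …, λ_n)`, numbered from `1`
(and `0` if `i = 0` or `i > n`). -/
def part {n : ℕ} (lam : Fin n → ℕ) (i : ℕ) : ℕ :=
  if h : 1 ≤ i ∧ i ≤ n then lam ⟨i - 1, by omega⟩ else 0

/-- `|λ| = λ_1 + ⋯ + λ_n`. -/
def size {n : ℕ} (lam : Fin n → ℕ) : ℕ := ∑ i, lam i

/-- The truncation `λ^{(ℓ)} = (λ_{ℓ+1}, …, λ_n)`. -/
def shift {n : ℕ} (lam : Fin n → ℕ) (l : ℕ) : Fin (n - l) → ℕ :=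
  fun i => lam ⟨i + l, by omega⟩

/-- The finite abelian `p`-group `G_λ = ℤ/p^{λ_1} ⊕ ⋯ ⊕ ℤ/p^{λ_n}`. -/
abbrev abelianPGroup {n : ℕ} (p : ℕ) (lam : Fin n → ℕ) : Type :=
  (i : Fin n) → ZMod (p ^ lam i)

/-- The number of subgroups of order `p ^ k` of `G_λ`. -/
noncomputable def subgroupCount {n : ℕ} (p : ℕ) (lam : Fin n → ℕ) (k : ℕ) : ℕ :=
  Nat.card {H : AddSubgroup (abelianPGroup p lam) // Nat.card H = p ^ k}

/-- `c_ℓ(λ) = λ_{ℓ+1} + λ_{ℓ+3} + ⋯`, the sum running over the indices in `[ℓ+1, n]` of the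
parity of `ℓ + 1`.  So `c_0 = λ_1 + λ_3 + ⋯`, `c_1 = λ_2 + λ_4 + ⋯` and `c_n = 0`. -/
def cSum {n : ℕ} (lam : Fin n → ℕ) (l : ℕ) : ℕ :=
  ∑ i ∈ Icc (l + 1) n with i % 2 = (l + 1) % 2, part lam i

/-- `ev_λ = λ_2 + λ_4 + ⋯`. -/
def evSum {n : ℕ} (lam : Fin n → ℕ) : ℕ := cSum lam 1

/-- `od_λ = λ_1 + λ_3 + ⋯`. -/
def odSum {n : ℕ} (lam : Fin n → ℕ) : ℕ := cSum lam 0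

/-- The integer interval `J_ℓ(λ) = [c_{ℓ+1}(λ), c_ℓ(λ)]` for `ℓ ≥ 0`;
in particular `J_0(λ) = [ev_λ, od_λ]`. -/
def J {n : ℕ} (lam : Fin n → ℕ) (l : ℕ) : Finset ℕ :=
  Icc (cSum lam (l + 1)) (cSum lam l)

/-- The integer interval `J_{-ℓ}(λ) = [|λ| - c_ℓ(λ), |λ| - c_{ℓ+1}(λ)]` for `ℓ ≥ 1`. -/
def JNeg {n : ℕ} (lam : Fin n → ℕ) (l : ℕ) : Finset ℕ :=
  Icc (size lam - cSum lam l) (size lam - cSum lam (l + 1))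

/-- `a_ℓ(λ) = ∑_{i = ℓ+2}^{n} ⌊(i - ℓ)/2⌋ λ_i`. -/
def aSum {n : ℕ} (lam : Fin n → ℕ) (l : ℕ) : ℕ :=
  ∑ i ∈ Icc (l + 2) n, (i - l) / 2 * part lam i

/-- The coefficient `C(n, λ; k)` for `0 ≤ k ≤ |λ|`, by recursion on `n`.  It is `1` for `n ≤ 2`.
For `n ≥ 3`, an index above `od_λ` is first replaced by its mirror image `|λ| - k`, which is at
most `ev_λ`.  Below `ev_λ` the coefficient is that of `λ' = (λ_2, …, λ_n)` (so after `ℓ` steps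
one arrives at `λ^{(ℓ)}` when `k` lies in `J_ℓ(λ)`), and on `[ev_λ, od_λ]` it is a sum of
coefficients of `λ'`.  The truncated difference in the lower limit of the sum is harmless
because of the maximum with `ev_λ ≥ 0`. -/
def coeffC : (n : ℕ) → (Fin n → ℕ) → ℕ → ℕ
  | 0, _, _ => 1
  | 1, _, _ => 1
  | 2, _, _ => 1
  | n + 3, lam, k =>
    let j := if k ≤ odSum lam then k else size lam - k
    if j < evSum lam then
      coeffC (n + 2) (shift lam 1) j
    else
      ∑ i ∈ Icc (max (evSum lam) (j + part lam 2 - part lam 1))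
          (min j (odSum lam - part lam 1 + part lam 2)),
        coeffC (n + 2) (shift lam 1) i

/-- The highest term of a polynomial, i.e. the monomial `c X^d` with `d` its degree and `c` its
leading coefficient. -/
noncomputable def highestTerm (P : ℤ[X]) : ℤ[X] := monomial P.natDegree P.leadingCoeff

/-- `f` is unimodal on the integer interval `[a, b]`: it increases weakly up to some `m` in
`[a, b]` and decreases weakly from `m` on. -/
def UnimodalOn (f : ℕ → ℕ) (a b : ℕ) : Prop :=
  ∃ m ∈ Set.Icc a b, MonotoneOn f (Set.Icc a m) ∧ AntitoneOn f (Set.Icc m b)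

/-! Attach to a subgroup H of a finite abelian p-group G the ranks r_0 ≥ r_1 ≥ ⋯ of H, pH, p²H, …;
the order of H is p to the sum of the r_j. Let m_0 ≥ m_1 ≥ ⋯ be the corresponding ranks for G, the
column heights of λ. The subgroups H with given pH = K, where K has rank s, are found by choosing
the p-torsion V of H between K[p] and G[p], and then H as a relative complement. This gives the
factor p^{s(m-r)} times a Gaussian binomial (m-s choose r-s), a monic polynomial of degree r(m-r)
whatever s is (`card_fiber_nsmul`, `card_subgroups_eq_subPoly`). So each chain of ranks contributes
a monic polynomial of degree ∑ r_j(m_j - r_j).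

Fix ℓ and subtract ℓk = ℓ∑ r_j: each summand r(m-ℓ-r) is largest exactly when r is an integer
nearest to (m-ℓ)/2. Hence the degree is at most ℓk + a_ℓ, and the coefficient there counts the
chains with every r_j near (m_j-ℓ)/2. Read by rows instead of columns, these are the tuples t with
λ_{2i+ℓ} ≤ t_i ≤ λ_{2i-1+ℓ} and sum k (`subPoly_natDegree_le_and_coeff`,
`countPoly_natDegree_le_and_coeff`).

The number of such tuples, `pairCount`, is an iterated convolution of indicators of intervals. It is
therefore symmetric and unimodal, is 1 at both ends c_{ℓ+1} and c_ℓ, is positive between them and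
vanishes outside; so the degree bound is sharp on J_ℓ. The recursive coefficients agree with these
counts (`coeffC_eq_pairCount_and_symm`): the recursion for k in J_0 is the convolution over t_1,
reindexed through the symmetries of λ' and λ''. The symmetry under k ↦ |λ| - k comes from duality of
finite abelian groups. -/

/-! ### Complements and relative complements in finite abelian groups -/

/-- The number of complements of a subspace over a finite field. -/
theorem card_isCompl {F E : Type*} [Field F] [Finite F] [AddCommGroup E] [Module F E] [Finite E]
    (q : Submodule F E) :
    Nat.card {r : Submodule F E // IsCompl q r} =
      Nat.card F ^ (Module.finrank F (E ⧸ q) * Module.finrank F q) := by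
  rw [Nat.card_congr q.isComplEquivProj]
  obtain ⟨f₀, hf₀⟩ := q.subtype.exists_leftInverse_of_injective (by simp)
  have hf₀' : ∀ x : q, f₀ x = x := fun x => LinearMap.congr_fun hf₀ x
  -- Complements are projections onto `q`, and these form a torsor under Hom(E/q, q) with base point
  -- `f₀`.
  have key : Function.Bijective (fun g : (E ⧸ q) →ₗ[F] q =>
      (⟨f₀ + g ∘ₗ q.mkQ, fun x => by
        simp [hf₀', (Submodule.Quotient.mk_eq_zero q).2 x.2]⟩ :
        {f : E →ₗ[F] q // ∀ x : q, f x = x})) := by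
    constructor
    · intro g g' h
      simp only [Subtype.mk.injEq, add_right_inj] at h
      ext x
      exact congrArg Subtype.val (LinearMap.congr_fun h x)
    · rintro ⟨f, hf⟩
      refine ⟨q.liftQ (f - f₀) fun x hx => ?_, ?_⟩
      · have h1 := hf ⟨x, hx⟩
        have h2 := hf₀' ⟨x, hx⟩
        simp only at h1 h2
        simp [h1, h2]
      · ext x
        simp
  rw [← Nat.card_congr (Equiv.ofBijective _ key), Module.natCard_eq_pow_finrank (K := F),
    Module.finrank_linearMap]

theorem AddSubgroup.card_sup_mul_card_inf {G : Type*} [AddCommGroup G] [Finite G]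
    (H K : AddSubgroup G) :
    Nat.card (H ⊔ K : AddSubgroup G) * Nat.card (H ⊓ K : AddSubgroup G) =
      Nat.card H * Nat.card K := by
  have h1 := AddSubgroup.relIndex_mul_relIndex (⊥ : AddSubgroup G) K (H ⊔ K) bot_le le_sup_right
  have h2 := AddSubgroup.relIndex_mul_relIndex (⊥ : AddSubgroup G) (H ⊓ K) H bot_le inf_le_left
  rw [AddSubgroup.relIndex_sup_right] at h1
  simp only [AddSubgroup.relIndex_bot_left, AddSubgroup.inf_relIndex_left] at h1 h2
  rw [← h1, ← h2]
  ring

theorem AddSubgroup.card_map_mul_card_inf_ker {G G' : Type*} [AddCommGroup G] [AddCommGroup G']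
    [Finite G] (f : G →+ G') (H : AddSubgroup G) :
    Nat.card (H.map f) * Nat.card (H ⊓ f.ker : AddSubgroup G) = Nat.card H := by
  have h2 := AddSubgroup.relIndex_mul_relIndex (⊥ : AddSubgroup G) (H ⊓ f.ker) H bot_le inf_le_left
  rw [AddSubgroup.relIndex_bot_left, AddSubgroup.relIndex_bot_left, AddSubgroup.inf_relIndex_left,
    AddSubgroup.relIndex_ker] at h2
  rw [← h2, mul_comm]

section RelativeComplements

variable {p : ℕ} [hp : Fact p.Prime]

theorem AddSubgroup.card_isCompl_of_zmodModule {E : Type*} [AddCommGroup E] [Finite E]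
    [Module (ZMod p) E] {N : AddSubgroup E} {s w : ℕ} (hw : Nat.card N = p ^ w)
    (hs : Nat.card E = p ^ (s + w)) :
    Nat.card {H : AddSubgroup E // IsCompl H N} = p ^ (s * w) := by
  let q : Submodule (ZMod p) E := AddSubgroup.toZModSubmodule p N
  have hqr : Module.finrank (ZMod p) q = w := by
    have h := Module.natCard_eq_pow_finrank (K := ZMod p) (V := q)
    rw [Nat.card_zmod] at h
    exact (Nat.pow_right_injective hp.out.two_le (hw.symm.trans h)).symm
  have hEr : Module.finrank (ZMod p) E = s + w := by
    have h := Module.natCard_eq_pow_finrank (K := ZMod p) (V := E)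
    rw [hs, Nat.card_zmod] at h
    exact (Nat.pow_right_injective hp.out.two_le h).symm
  have hquot : Module.finrank (ZMod p) (E ⧸ q) = s := by
    have := q.finrank_quotient_add_finrank
    omega
  have hcard := card_isCompl q
  rw [hqr, hquot, Nat.card_zmod] at hcard
  rw [← hcard]
  refine Nat.card_congr ((AddSubgroup.toZModSubmodule p).toEquiv.subtypeEquiv fun H => ?_)
  rw [(AddSubgroup.toZModSubmodule p).isCompl_iff, isCompl_comm]
  rfl

theorem AddSubgroup.card_isCompl_of_elementary {E : Type*} [AddCommGroup E] [Finite E]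
    (hE : ∀ x : E, p • x = 0) {N : AddSubgroup E} {s w : ℕ} (hw : Nat.card N = p ^ w)
    (hs : Nat.card E = p ^ (s + w)) :
    Nat.card {H : AddSubgroup E // IsCompl H N} = p ^ (s * w) :=
  let _ : Module (ZMod p) E := AddCommGroup.zmodModule hE
  AddSubgroup.card_isCompl_of_zmodModule hw hs

/-- Such an `H` contains `V`, and also pG, because p(y + z) = py for y in `H` and z in `N`. Hence
`H` contains U = V + pG and corresponds to a complement of the image of `N` in the elementary
abelian group G/U. The modular law gives N ∩ U = V, so this image has order p^w. -/
theorem card_relative_complements_top {G : Type*} [AddCommGroup G] [Finite G]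
    {V N : AddSubgroup G} {s w : ℕ} (hN : ∀ x ∈ N, p • x = 0) (hVN : V ≤ N)
    (hV : N ⊓ (⊤ : AddSubgroup G).map (nsmulAddMonoidHom p) ≤ V)
    (hw : Nat.card N = p ^ w * Nat.card V)
    (hs : Nat.card G = p ^ (s + w) *
      Nat.card (V ⊔ (⊤ : AddSubgroup G).map (nsmulAddMonoidHom p) : AddSubgroup G)) :
    Nat.card {H : AddSubgroup G // H ⊔ N = ⊤ ∧ H ⊓ N = V} = p ^ (s * w) := by
  set P := (⊤ : AddSubgroup G).map (nsmulAddMonoidHom p) with hP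
  set U := V ⊔ P with hU
  have hNU : N ⊓ U = V := by
    rw [hU, inf_comm, sup_inf_assoc_of_le _ hVN, inf_comm P N, sup_eq_left]
    exact hV
  have hel : ∀ x : G ⧸ U, p • x = 0 := by
    intro x
    obtain ⟨x, rfl⟩ := QuotientAddGroup.mk_surjective x
    rw [← QuotientAddGroup.mk_nsmul, QuotientAddGroup.eq_zero_iff]
    exact AddSubgroup.mem_sup_right ⟨x, trivial, rfl⟩
  let π := QuotientAddGroup.mk' U
  have hker : π.ker = U := QuotientAddGroup.ker_mk' U
  have hsurj : Function.Surjective π := QuotientAddGroup.mk'_surjective U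
  have hq : Nat.card (N.map π) = p ^ w := by
    have h2 := AddSubgroup.card_map_mul_card_inf_ker π N
    rw [hker, hNU, hw] at h2
    exact Nat.eq_of_mul_eq_mul_right Nat.card_pos h2
  have hE : Nat.card (G ⧸ U) = p ^ (s + w) := by
    have h2 := AddSubgroup.card_eq_card_quotient_mul_card_addSubgroup U
    rw [hs] at h2
    exact (Nat.eq_of_mul_eq_mul_right Nat.card_pos h2).symm
  rw [← AddSubgroup.card_isCompl_of_elementary hel hq hE]
  symm
  have hmapN : ∀ r : AddSubgroup (G ⧸ U), (r.comap π ⊔ N).map π = r ⊔ N.map π := fun r => by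
    rw [AddSubgroup.map_sup, AddSubgroup.map_comap_eq_self_of_surjective hsurj]
  have hUle : ∀ r : AddSubgroup (G ⧸ U), U ≤ r.comap π := fun r => by
    exact hker.symm.le.trans (AddSubgroup.ker_le_comap π r)
  have hinf : ∀ r : AddSubgroup (G ⧸ U), r.comap π ⊓ N = V ↔ r ⊓ N.map π = ⊥ := by
    intro r
    constructor
    · intro h
      rw [eq_bot_iff]
      rintro _ ⟨hy, x, hx, rfl⟩
      have : x ∈ V := h ▸ (⟨hy, hx⟩ : x ∈ r.comap π ⊓ N)
      have : x ∈ π.ker := by rw [hker]; exact AddSubgroup.mem_sup_left this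
      exact this
    · intro h
      apply le_antisymm
      · rintro x ⟨hx1, hx2⟩
        have : π x ∈ r ⊓ N.map π := ⟨hx1, x, hx2, rfl⟩
        rw [h] at this
        have : x ∈ π.ker := this
        rw [hker] at this
        rw [← hNU]
        exact ⟨hx2, this⟩
      · exact le_inf (le_sup_left.trans (hUle r)) hVN
  have hsup : ∀ r : AddSubgroup (G ⧸ U), r.comap π ⊔ N = ⊤ ↔ r ⊔ N.map π = ⊤ := by
    intro r
    rw [← hmapN]
    constructor
    · intro h
      rw [h, AddSubgroup.map_top_of_surjective _ hsurj]
    · intro h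
      rw [eq_top_iff]
      intro x _
      obtain ⟨y, hy, hxy⟩ : π x ∈ (r.comap π ⊔ N).map π := h ▸ AddSubgroup.mem_top _
      have : x - y ∈ π.ker := by rw [AddMonoidHom.mem_ker, map_sub, hxy, sub_self]
      rw [hker] at this
      have := AddSubgroup.add_mem _ (AddSubgroup.mem_sup_left (hUle r this)) hy
      simpa using this
  have hcompl : ∀ r : AddSubgroup (G ⧸ U), (r.comap π ⊔ N = ⊤ ∧ r.comap π ⊓ N = V) ↔
      IsCompl r (N.map π) := by
    intro r
    rw [hsup, hinf, isCompl_iff, disjoint_iff, codisjoint_iff, and_comm]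
  have hsurj2 : ∀ H : AddSubgroup G, H ⊔ N = ⊤ → H ⊓ N = V → (H.map π).comap π = H := by
    intro H h1 h2
    rw [AddSubgroup.comap_map_eq, hker, sup_eq_left]
    refine sup_le (h2 ▸ inf_le_left) ?_
    rintro _ ⟨x, -, rfl⟩
    obtain ⟨y, hy, z, hz, rfl⟩ := AddSubgroup.mem_sup.1 (h1 ▸ AddSubgroup.mem_top x)
    simpa [hN z hz] using H.nsmul_mem hy p
  refine Nat.card_congr
    { toFun := fun r => ⟨r.1.comap π, (hcompl r.1).2 r.2⟩
      invFun := fun H => ⟨H.1.map π, by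
        rw [← hcompl, hsurj2 _ H.2.1 H.2.2]; exact H.2⟩
      left_inv := fun r => by
        ext1
        exact AddSubgroup.map_comap_eq_self_of_surjective hsurj _
      right_inv := fun H => by
        ext1
        exact hsurj2 _ H.2.1 H.2.2 }

/-- The number of subgroups `H` with `H + N = L` and `H ∩ N = V`. -/
theorem card_relative_complements {G : Type*} [AddCommGroup G] [Finite G]
    {V N L : AddSubgroup G} {s w : ℕ} (hN : ∀ x ∈ N, p • x = 0) (hVN : V ≤ N) (hNL : N ≤ L)
    (hV : N ⊓ L.map (nsmulAddMonoidHom p) ≤ V)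
    (hw : Nat.card N = p ^ w * Nat.card V)
    (hs : Nat.card L = p ^ (s + w) *
      Nat.card (V ⊔ L.map (nsmulAddMonoidHom p) : AddSubgroup G)) :
    Nat.card {H : AddSubgroup G // H ⊔ N = L ∧ H ⊓ N = V} = p ^ (s * w) := by
  have hinj : Function.Injective (AddSubgroup.map L.subtype) :=
    AddSubgroup.map_injective L.subtype_injective
  have hmapof : ∀ K ≤ L, (K.addSubgroupOf L).map L.subtype = K := fun K hK =>
    AddSubgroup.map_addSubgroupOf_eq_of_le hK
  have hcardof : ∀ K ≤ L, Nat.card (K.addSubgroupOf L) = Nat.card K := fun K hK =>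
    Nat.card_congr (AddSubgroup.addSubgroupOfEquivOfLe hK).toEquiv
  have hpL : L.map (nsmulAddMonoidHom p) ≤ L := by
    rintro _ ⟨x, hx, rfl⟩
    exact L.nsmul_mem hx p
  have hpt : (⊤ : AddSubgroup L).map (nsmulAddMonoidHom p) =
      (L.map (nsmulAddMonoidHom p)).addSubgroupOf L := by
    apply hinj
    rw [hmapof _ hpL]
    ext x
    constructor
    · rintro ⟨_, ⟨y, -, rfl⟩, rfl⟩
      exact ⟨y, y.2, rfl⟩
    · rintro ⟨y, hy, rfl⟩
      exact ⟨_, ⟨⟨y, hy⟩, trivial, rfl⟩, rfl⟩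
  have hsupof : ∀ K ≤ L, ∀ K' ≤ L, K.addSubgroupOf L ⊔ K'.addSubgroupOf L =
      (K ⊔ K').addSubgroupOf L := by
    intro K hK K' hK'
    apply hinj
    rw [AddSubgroup.map_sup, hmapof _ hK, hmapof _ hK', hmapof _ (sup_le hK hK')]
  have hinfof : ∀ K ≤ L, ∀ K' ≤ L, K.addSubgroupOf L ⊓ K'.addSubgroupOf L =
      (K ⊓ K').addSubgroupOf L := fun K _ K' _ => rfl
  have htop : (⊤ : AddSubgroup L) = L.addSubgroupOf L := by simp
  have hmaptop : (⊤ : AddSubgroup L).map L.subtype = L := by rw [htop, hmapof L le_rfl]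
  -- Every `H` in question lies in `L`, so `L` can serve as the ambient group.
  have key := card_relative_complements_top (p := p) (G := L) (V := V.addSubgroupOf L)
    (N := N.addSubgroupOf L) (s := s) (w := w)
    (fun x hx => Subtype.ext (hN x hx))
    (AddSubgroup.comap_mono hVN)
    (by rw [hpt, hinfof _ hNL _ hpL]; exact AddSubgroup.comap_mono hV)
    (by rw [hcardof _ hNL, hcardof _ (hVN.trans hNL), hw])
    (by rw [hpt, hsupof _ (hVN.trans hNL) _ hpL, hcardof _ (sup_le (hVN.trans hNL) hpL), hs])
  rw [← key]
  refine Nat.card_congr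
    { toFun := fun H => ⟨H.1.addSubgroupOf L, by
        have hH : H.1 ≤ L := le_sup_left.trans_eq H.2.1
        constructor
        · rw [hsupof _ hH _ hNL, H.2.1, htop]
        · rw [hinfof _ hH _ hNL, H.2.2]⟩
      invFun := fun H => ⟨H.1.map L.subtype, by
        constructor
        · have h := congrArg (AddSubgroup.map L.subtype) H.2.1
          rwa [AddSubgroup.map_sup, hmapof N hNL, hmaptop] at h
        · have h := congrArg (AddSubgroup.map L.subtype) H.2.2
          rwa [AddSubgroup.map_inf _ _ _ L.subtype_injective, hmapof N hNL,
            hmapof V (hVN.trans hNL)] at h⟩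
      left_inv := fun H => by
        have hH : H.1 ≤ L := le_sup_left.trans_eq H.2.1
        ext1
        exact hmapof _ hH
      right_inv := fun H => by
        ext1
        apply hinj
        exact hmapof _ (AddSubgroup.map_subtype_le _) }

end RelativeComplements

/-! ### Counting subgroups by order and rank -/

theorem Nat.card_subtype_eq_sum {α ι : Type*} [Finite α] (t : Finset ι) (P : α → Prop)
    (R : ι → α → Prop) (hex : ∀ a, P a → ∃ s ∈ t, R s a)
    (huniq : ∀ a s s', R s a → R s' a → s = s') :
    Nat.card {a // P a} = ∑ s ∈ t, Nat.card {a // P a ∧ R s a} := by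
  classical
  have := Fintype.ofFinite α
  simp only [Nat.card_eq_fintype_card, Fintype.card_subtype]
  rw [← Finset.card_biUnion]
  · congr 1
    ext a
    simp only [mem_filter, mem_univ, true_and, mem_biUnion]
    constructor
    · intro h
      obtain ⟨s, hs, hR⟩ := hex a h
      exact ⟨s, hs, h, hR⟩
    · rintro ⟨s, -, h, -⟩
      exact h
  · intro s _ s' _ hss'
    rw [Function.onFun, Finset.disjoint_left]
    intro a ha ha'
    exact hss' (huniq a s s' (mem_filter.1 ha).2.2 (mem_filter.1 ha').2.2)

theorem Nat.card_subtype_eq_mul {α β : Type*} [Finite α] [Finite β] {P : α → Prop} {Q : β → Prop}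
    (f : α → β) {c : ℕ} (hf : ∀ a, P a → Q (f a))
    (hc : ∀ b, Q b → Nat.card {a // P a ∧ f a = b} = c) :
    Nat.card {a // P a} = Nat.card {b // Q b} * c := by
  classical
  have := Fintype.ofFinite β
  rw [Nat.card_subtype_eq_sum (univ.filter Q) P (fun b a => f a = b)
    (fun a ha => ⟨f a, by simpa using hf a ha, rfl⟩) (fun a s s' h h' => h.symm.trans h'),
    Finset.sum_congr rfl fun b hb => hc b (mem_filter.1 hb).2]
  simp [Nat.card_eq_fintype_card, Fintype.card_subtype]

/-- The Gaussian binomial coefficient as a polynomial in `q`. -/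
noncomputable def gauss : ℕ → ℕ → ℤ[X]
  | _, 0 => 1
  | 0, _ + 1 => 0
  | m + 1, r + 1 => gauss m r + X ^ (r + 1) * gauss m (r + 1)

/-- The number of subgroups of order `p ^ k` and rank `r` of a finite abelian `p`-group of
exponent dividing `p ^ e`, the conjugate of whose type is `m`, as a polynomial in `p`. -/
noncomputable def subPoly : ℕ → (ℕ → ℕ) → ℕ → ℕ → ℤ[X]
  | 0, _, k, r => if k = 0 ∧ r = 0 then 1 else 0
  | e + 1, m, k, r =>
    if r ≤ k ∧ r ≤ m 0 then
      ∑ s ∈ range (r + 1), subPoly e (fun j => m (j + 1)) (k - r) s *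
        (X ^ (s * (m 0 - r)) * gauss (m 0 - s) (r - s))
    else 0

section

variable {p : ℕ} [hp : Fact p.Prime] {G : Type*} [AddCommGroup G] [Finite G]

theorem exists_card_eq_prime_mul {K N : AddSubgroup G} (hN : ∀ x ∈ N, p • x = 0) (hKN : K < N) :
    ∃ K' ≤ N, K < K' ∧ Nat.card K' = p * Nat.card K := by
  obtain ⟨x, hxN, hxK⟩ := SetLike.exists_of_lt hKN
  have hx0 : x ≠ 0 := fun h => hxK (h ▸ K.zero_mem)
  have hcard : Nat.card (AddSubgroup.zmultiples x) = p := by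
    rw [Nat.card_zmultiples]
    exact addOrderOf_eq_prime (hN x hxN) hx0
  have hinf : K ⊓ AddSubgroup.zmultiples x = ⊥ := by
    have hdvd := AddSubgroup.card_dvd_of_le
      (inf_le_right : K ⊓ AddSubgroup.zmultiples x ≤ AddSubgroup.zmultiples x)
    rw [hcard] at hdvd
    rcases (Nat.dvd_prime hp.out).1 hdvd with h | h
    · exact AddSubgroup.card_eq_one.1 h
    · exfalso
      have := AddSubgroup.eq_of_le_of_card_ge
        (inf_le_right : K ⊓ AddSubgroup.zmultiples x ≤ AddSubgroup.zmultiples x)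
        (by rw [h, hcard])
      exact hxK (inf_eq_right.1 this (AddSubgroup.mem_zmultiples x))
  refine ⟨K ⊔ AddSubgroup.zmultiples x, sup_le hKN.le ?_, ?_, ?_⟩
  · rwa [AddSubgroup.zmultiples_le]
  · refine lt_of_le_of_ne le_sup_left fun h => hxK ?_
    rw [h]
    exact AddSubgroup.mem_sup_right (AddSubgroup.mem_zmultiples x)
  · have := AddSubgroup.card_sup_mul_card_inf K (AddSubgroup.zmultiples x)
    rw [hinf, hcard, AddSubgroup.card_bot, mul_one] at this
    rw [this, mul_comm]

/-- The index of `K` in `K'` is prime, so V ∩ K', which lies between them, is one of the two. -/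
theorem inf_eq_of_card_eq_prime_mul {K K' V : AddSubgroup G} (hKK' : K ≤ K')
    (hcard : Nat.card K' = p * Nat.card K) (hKV : K ≤ V) (hV : ¬ K' ≤ V) : V ⊓ K' = K := by
  have h1 : K ≤ V ⊓ K' := le_inf hKV hKK'
  have h2 := AddSubgroup.relIndex_mul_relIndex K (V ⊓ K') K' h1 inf_le_right
  have h3 := AddSubgroup.relIndex_mul_relIndex (⊥ : AddSubgroup G) K K' bot_le hKK'
  rw [AddSubgroup.relIndex_bot_left, AddSubgroup.relIndex_bot_left, hcard, mul_comm p] at h3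
  have h4 := Nat.eq_of_mul_eq_mul_left Nat.card_pos h3
  rw [h4] at h2
  rcases (Nat.dvd_prime hp.out).1 (Dvd.intro _ h2) with h | h
  · exact le_antisymm (AddSubgroup.relIndex_eq_one.1 h) h1
  · rw [h] at h2
    have : (V ⊓ K').relIndex K' = 1 := by
      have := hp.out.pos
      nlinarith
    exact absurd ((AddSubgroup.relIndex_eq_one.1 this).trans inf_le_left) hV

/-- Subgroups between two subgroups of an elementary abelian group are counted by Gaussian
binomial coefficients. -/
theorem card_between_eq_gauss {N : AddSubgroup G} (hN : ∀ x ∈ N, p • x = 0) (M : ℕ) :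
    ∀ (K : AddSubgroup G) (R : ℕ), K ≤ N → Nat.card N = p ^ M * Nat.card K →
      (Nat.card {V : AddSubgroup G // K ≤ V ∧ V ≤ N ∧ Nat.card V = p ^ R * Nat.card K} : ℤ) =
        (gauss M R).eval (p : ℤ) := by
  have hp1 := hp.out.one_lt
  have hR0 : ∀ (M : ℕ) (K : AddSubgroup G), K ≤ N →
      (Nat.card {V : AddSubgroup G // K ≤ V ∧ V ≤ N ∧ Nat.card V = p ^ 0 * Nat.card K} : ℤ) =
        (gauss M 0).eval (p : ℤ) := by
    intro M K hK
    have : gauss M 0 = 1 := by cases M <;> rfl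
    rw [this, eval_one, Nat.cast_eq_one, Nat.card_eq_one_iff_unique]
    refine ⟨⟨fun V V' => Subtype.ext ?_⟩, ⟨K, le_rfl, hK, by simp⟩⟩
    have h : ∀ V : {V : AddSubgroup G // K ≤ V ∧ V ≤ N ∧ Nat.card V = p ^ 0 * Nat.card K},
        K = V.1 := fun V =>
      AddSubgroup.eq_of_le_of_card_ge V.2.1 (by rw [V.2.2.2]; simp)
    rw [← h V, ← h V']
  induction M with
  | zero =>
    intro K R hK hcard
    rcases R with _ | R
    · exact hR0 0 K hK
    · have : gauss 0 (R + 1) = 0 := rfl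
      rw [this, eval_zero, Nat.cast_eq_zero]
      have : IsEmpty
          {V : AddSubgroup G // K ≤ V ∧ V ≤ N ∧ Nat.card V = p ^ (R + 1) * Nat.card K} := by
        refine ⟨fun V => ?_⟩
        have h1 := AddSubgroup.card_le_of_le V.2.2.1
        have h2 : 0 < Nat.card K := Nat.card_pos
        have h3 : 1 < p ^ (R + 1) := Nat.one_lt_pow (by omega) hp1
        rw [V.2.2.2, hcard] at h1
        nlinarith
      exact Nat.card_of_isEmpty
  | succ M ih =>
    intro K R hK hcard
    rcases R with _ | R
    · exact hR0 _ K hK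
    have hne : K ≠ N := by
      rintro rfl
      have h2 : 0 < Nat.card K := Nat.card_pos
      have h3 : 1 < p ^ (M + 1) := Nat.one_lt_pow (by omega) hp1
      nlinarith
    obtain ⟨K', hK'N, hKK', hK'⟩ := exists_card_eq_prime_mul hN (lt_of_le_of_ne hK hne)
    have hcard' : Nat.card N = p ^ M * Nat.card K' := by rw [hcard, hK']; ring
    -- Pascal's rule: either `V` contains `K'`, or V ∩ K' = K. In the second case V ↦ V + K' has
    -- fibres consisting of relative complements, of size p^(R+1).
    have hsplit := Nat.card_subtype_eq_sum (α := AddSubgroup G) (univ : Finset Bool)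
      (fun V => K ≤ V ∧ V ≤ N ∧ Nat.card V = p ^ (R + 1) * Nat.card K)
      (fun b V => (b = true ↔ K' ≤ V)) (fun V _ => by
        by_cases h : K' ≤ V
        · exact ⟨true, mem_univ _, by simp [h]⟩
        · exact ⟨false, mem_univ _, by simp [h]⟩)
      (fun V b b' h h' => by
        rw [Bool.eq_iff_iff, h, h'])
    rw [hsplit, Fintype.sum_bool]
    have h1 : Nat.card {V : AddSubgroup G // (K ≤ V ∧ V ≤ N ∧
        Nat.card V = p ^ (R + 1) * Nat.card K) ∧ (true = true ↔ K' ≤ V)} =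
        Nat.card {V : AddSubgroup G // K' ≤ V ∧ V ≤ N ∧ Nat.card V = p ^ R * Nat.card K'} := by
      refine Nat.card_congr (Equiv.subtypeEquivRight fun V => ?_)
      have : p ^ (R + 1) * Nat.card K = p ^ R * Nat.card K' := by rw [hK']; ring
      rw [this]
      constructor
      · rintro ⟨⟨-, h2, h3⟩, h4⟩
        exact ⟨h4.1 rfl, h2, h3⟩
      · rintro ⟨h1, h2, h3⟩
        exact ⟨⟨hKK'.le.trans h1, h2, h3⟩, by simp [h1]⟩
    have h2 : Nat.card {V : AddSubgroup G // (K ≤ V ∧ V ≤ N ∧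
        Nat.card V = p ^ (R + 1) * Nat.card K) ∧ (false = true ↔ K' ≤ V)} =
        Nat.card {V : AddSubgroup G // K' ≤ V ∧ V ≤ N ∧
          Nat.card V = p ^ (R + 1) * Nat.card K'} * p ^ ((R + 1) * 1) := by
      refine Nat.card_subtype_eq_mul (fun V => V ⊔ K') ?_ ?_
      · rintro V ⟨⟨h2, h3, h4⟩, h5⟩
        have h6 : V ⊓ K' = K :=
          inf_eq_of_card_eq_prime_mul hKK'.le hK' h2 (fun h => by simp [h] at h5)
        refine ⟨le_sup_right, sup_le h3 hK'N, ?_⟩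
        have h7 := AddSubgroup.card_sup_mul_card_inf V K'
        rw [h6, h4, mul_assoc, mul_comm (Nat.card K), ← mul_assoc] at h7
        exact Nat.eq_of_mul_eq_mul_right Nat.card_pos h7
      · rintro L ⟨hL1, hL2, hL3⟩
        have hpL : L.map (nsmulAddMonoidHom p) = ⊥ := by
          rw [eq_bot_iff]
          rintro _ ⟨x, hx, rfl⟩
          exact hN x (hL2 hx)
        rw [← card_relative_complements (G := G) (V := K) (N := K') (L := L) (s := R + 1) (w := 1)
          (fun x hx => hN x (hK'N hx)) hKK'.le hL1 (by simp [hpL]) (by simpa using hK')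
          (by rw [hpL, hL3, hK', sup_bot_eq]; ring)]
        refine Nat.card_congr (Equiv.subtypeEquivRight fun V => ?_)
        constructor
        · rintro ⟨⟨⟨h2, h3, h4⟩, h5⟩, h6⟩
          exact ⟨h6, inf_eq_of_card_eq_prime_mul hKK'.le hK' h2 (fun h => by simp [h] at h5)⟩
        · rintro ⟨h2, h3⟩
          refine ⟨⟨⟨h3 ▸ inf_le_left, (le_sup_left.trans_eq h2).trans hL2, ?_⟩, ?_⟩, h2⟩
          · have h7 := AddSubgroup.card_sup_mul_card_inf V K'
            rw [h2, h3, hL3, mul_assoc, mul_comm (Nat.card K'), ← mul_assoc] at h7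
            exact (Nat.eq_of_mul_eq_mul_right Nat.card_pos h7).symm
          · simp only [Bool.false_eq_true, false_iff]
            intro h
            rw [inf_eq_right.2 h] at h3
            exact hKK'.ne' h3
    have hg : gauss (M + 1) (R + 1) = gauss M R + X ^ (R + 1) * gauss M (R + 1) := rfl
    rw [h1, h2, hg]
    push_cast
    rw [ih K' R hK'N hcard', ih K' (R + 1) hK'N hcard']
    simp only [eval_add, eval_mul, eval_pow, eval_X]
    ring

end

section

variable {p : ℕ} [hp : Fact p.Prime] {G : Type*} [AddCommGroup G] [Finite G]

/-- The number of subgroups `H` of `A` with given image `p H = K` and given rank. -/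
theorem card_fiber_nsmul {A K : AddSubgroup G} {m s r : ℕ} (hsr : s ≤ r) (hrm : r ≤ m)
    (hA : Nat.card (A ⊓ (nsmulAddMonoidHom p).ker : AddSubgroup G) = p ^ m)
    (hKA : K ≤ A.map (nsmulAddMonoidHom p))
    (hK : Nat.card (K ⊓ (nsmulAddMonoidHom p).ker : AddSubgroup G) = p ^ s) :
    (Nat.card {H : AddSubgroup G // (H ≤ A ∧
      Nat.card (H ⊓ (nsmulAddMonoidHom p).ker : AddSubgroup G) = p ^ r) ∧
      H.map (nsmulAddMonoidHom p) = K} : ℤ) =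
      (X ^ (s * (m - r)) * gauss (m - s) (r - s)).eval (p : ℤ) := by
  set f : G →+ G := nsmulAddMonoidHom p with hf
  set T := f.ker with hT
  have hfH : ∀ H : AddSubgroup G, H.map f ≤ H := by
    rintro H _ ⟨x, hx, rfl⟩
    exact H.nsmul_mem hx p
  have hKleA : K ≤ A := hKA.trans (hfH A)
  have hTN : ∀ x ∈ A ⊓ T, p • x = 0 := fun x hx => hx.2
  have hgauss := card_between_eq_gauss hTN (m - s) (K ⊓ T) (r - s) (inf_le_inf_right T hKleA)
    (by rw [hA, hK, ← pow_add]; congr 1; omega)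
  rw [eval_mul, ← hgauss, eval_pow, eval_X, mul_comm, Nat.card_subtype_eq_mul
    (Q := fun V : AddSubgroup G => K ⊓ T ≤ V ∧ V ≤ A ⊓ T ∧
      Nat.card V = p ^ (r - s) * Nat.card (K ⊓ T : AddSubgroup G))
    (c := p ^ (s * (m - r))) (fun H => H ⊓ T)]
  · push_cast
    ring
  · rintro H ⟨⟨hHA, hHr⟩, hHK⟩
    refine ⟨inf_le_inf_right T (hHK ▸ hfH H), inf_le_inf_right T hHA, ?_⟩
    rw [hHr, hK, ← pow_add]
    congr 1
    omega
  · rintro V ⟨hV1, hV2, hV3⟩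
    have hVr : Nat.card V = p ^ r := by
      rw [hV3, hK, ← pow_add]
      congr 1
      omega
    -- Given V = H[p], the conditions H ≤ A and pH = K say that `H` is a relative complement of A[p]
    -- in this `L`. Since |L| = p^m |K| and |V + K| = p^(r-s) |K|, the index of V + K in `L` is p^(s
    -- + (m - r)).
    set L := A ⊓ K.comap f with hL
    have hpL : L.map f = K := by
      apply le_antisymm
      · rintro _ ⟨x, hx, rfl⟩
        exact hx.2
      · intro k hk
        obtain ⟨a, ha, rfl⟩ := hKA hk
        exact ⟨a, ⟨ha, hk⟩, rfl⟩
    have hNL : A ⊓ T ≤ L := inf_le_inf_left A fun x hx => by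
      have : f x = 0 := hx
      rw [AddSubgroup.mem_comap, this]
      exact K.zero_mem
    have hLT : L ⊓ T = A ⊓ T :=
      le_antisymm (inf_le_inf_right T inf_le_left) (le_inf hNL inf_le_right)
    have hVK : V ⊓ K = K ⊓ T :=
      le_antisymm (le_inf inf_le_right (inf_le_left.trans (hV2.trans inf_le_right)))
        (le_inf hV1 inf_le_left)
    have hcardL := AddSubgroup.card_map_mul_card_inf_ker f L
    have hcardVK := AddSubgroup.card_sup_mul_card_inf V K
    rw [hpL, ← hT, hLT, hA] at hcardL
    rw [hVK, hK, hVr] at hcardVK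
    rw [← card_relative_complements (G := G) (V := V) (N := A ⊓ T) (L := L) (s := s) (w := m - r)
      hTN hV2 hNL (by rw [← hf, hpL]; exact fun x hx => hV1 ⟨hx.2, hx.1.2⟩)
      (by rw [hA, hVr, ← pow_add]; congr 1; omega)
      (by
        rw [← hf, hpL, ← hcardL]
        refine Nat.eq_of_mul_eq_mul_right (pow_pos hp.out.pos s) ?_
        rw [mul_assoc _ (Nat.card _), hcardVK, mul_assoc, ← pow_add, ← mul_assoc, ← pow_add,
          mul_comm]
        congr 2
        omega)]
    refine Nat.card_congr (Equiv.subtypeEquivRight fun H => ?_)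
    constructor
    · rintro ⟨⟨⟨h1, h2⟩, h3⟩, h4⟩
      refine ⟨?_, ?_⟩
      · rw [hL, ← h3, AddSubgroup.comap_map_eq, ← hT, inf_comm A (H ⊔ T), sup_inf_assoc_of_le _ h1,
          inf_comm]
      · rw [← h4, ← inf_assoc, inf_eq_left.2 h1]
    · rintro ⟨h1, h2⟩
      have h3 : H ≤ A := (le_sup_left.trans_eq h1).trans inf_le_left
      have h4 : H ⊓ T = V := by rw [← h2, ← inf_assoc, inf_eq_left.2 h3]
      refine ⟨⟨⟨h3, h4 ▸ hVr⟩, ?_⟩, h4⟩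
      rw [← hpL, ← h1, AddSubgroup.map_sup]
      have : (A ⊓ T).map f = ⊥ := by
        rw [eq_bot_iff]
        rintro _ ⟨x, hx, rfl⟩
        exact hx.2
      rw [this, sup_bot_eq]

/-- Subgroups of given order and rank are counted by `subPoly`. -/
theorem card_subgroups_eq_subPoly (e : ℕ) :
    ∀ (A : AddSubgroup G) (m : ℕ → ℕ) (k r : ℕ), A.map (nsmulAddMonoidHom (p ^ e)) = ⊥ →
      (∀ j, Nat.card (A.map (nsmulAddMonoidHom (p ^ j)) ⊓ (nsmulAddMonoidHom p).ker :
        AddSubgroup G) = p ^ m j) →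
      (Nat.card {H : AddSubgroup G // H ≤ A ∧ Nat.card H = p ^ k ∧
        Nat.card (H ⊓ (nsmulAddMonoidHom p).ker : AddSubgroup G) = p ^ r} : ℤ) =
        (subPoly e m k r).eval (p : ℤ) := by
  have hp2 := hp.out.two_le
  have hpinj := Nat.pow_right_injective hp2
  have hone : ∀ A : AddSubgroup G, A.map (nsmulAddMonoidHom (p ^ 0)) = A := by
    intro A
    ext x
    simp
  induction e with
  | zero =>
    intro A m k r hA hm
    rw [hone] at hA
    subst hA
    have h1 : ∀ k : ℕ, 1 = p ^ k ↔ k = 0 := fun k =>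
      ⟨fun h => (hpinj (by simpa using h) : 0 = k).symm, fun h => by simp [h]⟩
    rw [subPoly]
    split_ifs with h
    · rw [eval_one, Nat.cast_eq_one, Nat.card_eq_one_iff_unique]
      refine ⟨⟨fun H H' => Subtype.ext ?_⟩, ⟨⊥, le_rfl, ?_, ?_⟩⟩
      · rw [le_bot_iff.1 H.2.1, le_bot_iff.1 H'.2.1]
      · simp [h.1]
      · simp [h.2]
    · rw [eval_zero, Nat.cast_eq_zero]
      have : IsEmpty {H : AddSubgroup G // H ≤ ⊥ ∧ Nat.card H = p ^ k ∧
        Nat.card (H ⊓ (nsmulAddMonoidHom p).ker : AddSubgroup G) = p ^ r} := by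
        refine ⟨fun ⟨H, h1', h2, h3⟩ => h ?_⟩
        obtain rfl := le_bot_iff.1 h1'
        rw [AddSubgroup.card_bot] at h2
        rw [bot_inf_eq, AddSubgroup.card_bot] at h3
        exact ⟨(h1 k).1 h2, (h1 r).1 h3⟩
      exact Nat.card_of_isEmpty
  | succ e ih =>
    intro A m k r hA hm
    set f : G →+ G := nsmulAddMonoidHom p with hf
    have hmap : ∀ j, (A.map f).map (nsmulAddMonoidHom (p ^ j)) =
        A.map (nsmulAddMonoidHom (p ^ (j + 1))) := by
      intro j
      rw [AddSubgroup.map_map]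
      congr 1
      ext x
      simp [hf, mul_smul, pow_succ]
    have hfH : ∀ H : AddSubgroup G, H.map f ≤ H := by
      rintro H _ ⟨x, hx, rfl⟩
      exact H.nsmul_mem hx p
    have hm0 : Nat.card (A ⊓ f.ker : AddSubgroup G) = p ^ m 0 := by
      rw [← hm 0, hone]
    rw [subPoly]
    split_ifs with h
    swap
    · rw [eval_zero, Nat.cast_eq_zero]
      have : IsEmpty {H : AddSubgroup G // H ≤ A ∧ Nat.card H = p ^ k ∧
        Nat.card (H ⊓ f.ker : AddSubgroup G) = p ^ r} := by
        refine ⟨fun ⟨H, h1', h2, h3⟩ => h ⟨?_, ?_⟩⟩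
        · rw [← Nat.pow_le_pow_iff_right hp2, ← h2, ← h3]
          exact AddSubgroup.card_le_of_le inf_le_left
        · rw [← Nat.pow_le_pow_iff_right hp2, ← hm0, ← h3]
          exact AddSubgroup.card_le_of_le (inf_le_inf_right _ h1')
      exact Nat.card_of_isEmpty
    · rw [Nat.card_subtype_eq_sum (range (r + 1)) _
        (fun s (H : AddSubgroup G) =>
          Nat.card (H.map f ⊓ f.ker : AddSubgroup G) = p ^ s)]
      · rw [Nat.cast_sum, eval_finsetSum]
        refine Finset.sum_congr rfl fun s hs => ?_
        have hsr : s ≤ r := Nat.lt_succ_iff.1 (mem_range.1 hs)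
        have ih' := ih (A.map f) (fun j => m (j + 1)) (k - r) s (by rw [hmap, hA])
          (fun j => by rw [hmap]; exact hm (j + 1))
        rw [eval_mul, ← ih']
        have hfib : ∀ K : AddSubgroup G, (K ≤ A.map f ∧ Nat.card K = p ^ (k - r) ∧
            Nat.card (K ⊓ f.ker : AddSubgroup G) = p ^ s) →
            Nat.card {H : AddSubgroup G // ((H ≤ A ∧ Nat.card H = p ^ k ∧
              Nat.card (H ⊓ f.ker : AddSubgroup G) = p ^ r) ∧
              Nat.card (H.map f ⊓ f.ker : AddSubgroup G) = p ^ s) ∧ H.map f = K} =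
            -- The fibre size has to be a natural number. The evaluated polynomial is visibly
            -- nonnegative once some `K` exists, being then a cardinality; if none exists, both
            -- sides vanish.
            ((X ^ (s * (m 0 - r)) * gauss (m 0 - s) (r - s)).eval (p : ℤ)).toNat := by
          rintro K ⟨hK1, hK2, hK3⟩
          rw [← card_fiber_nsmul hsr h.2 hm0 hK1 hK3, Int.toNat_natCast]
          refine Nat.card_congr (Equiv.subtypeEquivRight fun H => ?_)
          constructor
          · rintro ⟨⟨⟨h1, h2, h3⟩, h4⟩, h5⟩
            exact ⟨⟨h1, h3⟩, h5⟩
          · rintro ⟨⟨h1, h3⟩, h5⟩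
            refine ⟨⟨⟨h1, ?_, h3⟩, by rw [h5, hK3]⟩, h5⟩
            rw [← AddSubgroup.card_map_mul_card_inf_ker f H, h5, h3, hK2, ← pow_add]
            congr 1
            omega
        rw [Nat.card_subtype_eq_mul (fun H : AddSubgroup G => H.map f) ?_ hfib]
        · push_cast
          by_cases hne : Nonempty {K : AddSubgroup G // K ≤ A.map f ∧ Nat.card K = p ^ (k - r) ∧
            Nat.card (K ⊓ f.ker : AddSubgroup G) = p ^ s}
          · obtain ⟨K, hK1, hK2, hK3⟩ := hne
            rw [Int.toNat_of_nonneg]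
            rw [← card_fiber_nsmul hsr h.2 hm0 hK1 hK3]
            positivity
          · rw [not_nonempty_iff] at hne
            rw [Nat.card_of_isEmpty]
            simp
        · rintro H ⟨⟨h1, h2, h3⟩, h4⟩
          refine ⟨AddSubgroup.map_mono h1, ?_, h4⟩
          have h5 := AddSubgroup.card_map_mul_card_inf_ker f H
          rw [h2, h3] at h5
          refine Nat.eq_of_mul_eq_mul_right (pow_pos hp.out.pos r) ?_
          rw [h5, ← pow_add]
          congr 1
          omega
      · rintro H ⟨h1, h2, h3⟩
        have h4 := AddSubgroup.card_le_of_le (inf_le_inf_right f.ker (hfH H))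
        have h5 := AddSubgroup.card_dvd_of_le
          ((inf_le_left.trans (hfH H) : H.map f ⊓ f.ker ≤ H))
        rw [h2, Nat.dvd_prime_pow hp.out] at h5
        obtain ⟨s, -, hs⟩ := h5
        refine ⟨s, ?_, hs⟩
        rw [hs, h3, Nat.pow_le_pow_iff_right hp2] at h4
        exact mem_range.2 (by omega)
      · intro H s s' h1 h2
        exact hpinj (h1.symm.trans h2)

end

/-! ### Duality -/

/-- Sending `H` to its annihilator in the character group, which is isomorphic to `Γ`, turns order
into index. -/
theorem CommGroup.card_subgroup_eq_of_card_eq_mul {Γ : Type*} [CommGroup Γ] [Finite Γ] {a b : ℕ}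
    (hab : Nat.card Γ = a * b) :
    Nat.card {H : Subgroup Γ // Nat.card H = a} = Nat.card {H : Subgroup Γ // Nat.card H = b} := by
  have hne : NeZero (Monoid.exponent Γ) := ⟨Monoid.exponent_ne_zero_of_finite⟩
  obtain ⟨φ⟩ := CommGroup.monoidHom_mulEquiv_of_hasEnoughRootsOfUnity Γ ℂ
  have hpos : 0 < a * b := hab ▸ Nat.card_pos
  have ha : 0 < a := Nat.pos_of_mul_pos_right hpos
  have hb : 0 < b := Nat.pos_of_mul_pos_left hpos
  refine Nat.card_congr (Equiv.subtypeEquiv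
    ((CommGroup.subgroupOrderIsoSubgroupMonoidHom Γ ℂ).toEquiv.trans
      (OrderDual.ofDual.trans φ.mapSubgroup.toEquiv)) fun H => ?_)
  have h1 := CommGroup.card_subgroupOrderIsoSubgroupMonoidHom (M := ℂ) H
  have h2 := H.card_eq_card_quotient_mul_card_subgroup
  have h3 : Nat.card (φ.mapSubgroup
      (OrderDual.ofDual (CommGroup.subgroupOrderIsoSubgroupMonoidHom Γ ℂ H))) =
      Nat.card (Γ ⧸ H) := by
    rw [← h1]
    exact (Nat.card_congr ((OrderDual.ofDual
      (CommGroup.subgroupOrderIsoSubgroupMonoidHom Γ ℂ H)).equivMapOfInjective _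
        φ.injective).toEquiv).symm
  change Nat.card H = a ↔ Nat.card (φ.mapSubgroup
      (OrderDual.ofDual (CommGroup.subgroupOrderIsoSubgroupMonoidHom Γ ℂ H))) = b
  rw [h3]
  rw [hab] at h2
  constructor
  · intro h
    rw [h, mul_comm] at h2
    exact (Nat.eq_of_mul_eq_mul_right ha h2).symm
  · intro h
    rw [h, mul_comm] at h2
    exact (Nat.eq_of_mul_eq_mul_left hb h2).symm

theorem AddCommGroup.card_addSubgroup_eq_of_card_eq_mul {G : Type*} [AddCommGroup G] [Finite G]
    {a b : ℕ} (hab : Nat.card G = a * b) :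
    Nat.card {H : AddSubgroup G // Nat.card H = a} =
      Nat.card {H : AddSubgroup G // Nat.card H = b} := by
  have key : ∀ c, Nat.card {H : AddSubgroup G // Nat.card H = c} =
      Nat.card {H : Subgroup (Multiplicative G) // Nat.card H = c} := fun c =>
    Nat.card_congr (AddSubgroup.toSubgroup.toEquiv.subtypeEquiv fun H => Iff.rfl)
  rw [key, key]
  exact CommGroup.card_subgroup_eq_of_card_eq_mul hab

/-! ### The counting polynomial of G_λ -/

/-- The length of the column of `λ` with index `j`, numbered from `0`. -/
def colHeight {n : ℕ} (lam : Fin n → ℕ) (j : ℕ) : ℕ := #{i | j < lam i}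

theorem ZMod.card_nsmul_ker (p : ℕ) [hp : Fact p.Prime] (a j : ℕ) :
    Nat.card {x : ZMod (p ^ a) // p ^ j • x = 0} = p ^ min j a := by
  have : NeZero (p ^ a) := ⟨pow_ne_zero _ hp.out.ne_zero⟩
  have h := IsAddCyclic.card_nsmulAddMonoidHom_ker (G := ZMod (p ^ a)) (p ^ j)
  have h2 : Nat.card {x : ZMod (p ^ a) // p ^ j • x = 0} =
      Nat.card (nsmulAddMonoidHom (α := ZMod (p ^ a)) (p ^ j)).ker := rfl
  rw [h2, h, Nat.card_zmod]
  rcases le_total j a with hja | hja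
  · rw [min_eq_left hja, Nat.gcd_eq_right (pow_dvd_pow p hja)]
  · rw [min_eq_right hja, Nat.gcd_eq_left (pow_dvd_pow p hja)]

section

variable {n : ℕ} (lam : Fin n → ℕ) (p : ℕ) [hp : Fact p.Prime]

instance finite_abelianPGroup : Finite (abelianPGroup p lam) := by
  have : ∀ i, NeZero (p ^ lam i) := fun i => ⟨pow_ne_zero _ hp.out.ne_zero⟩
  exact Pi.finite

theorem card_abelianPGroup : Nat.card (abelianPGroup p lam) = p ^ size lam := by
  simp [abelianPGroup, size, Finset.prod_pow_eq_pow_sum]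

theorem card_map_pow_abelianPGroup (j : ℕ) :
    Nat.card ((⊤ : AddSubgroup (abelianPGroup p lam)).map (nsmulAddMonoidHom (p ^ j))) =
      p ^ ∑ i, (lam i - j) := by
  have h1 := AddSubgroup.card_map_mul_card_inf_ker
    (nsmulAddMonoidHom (α := abelianPGroup p lam) (p ^ j)) ⊤
  have h2 : Nat.card (nsmulAddMonoidHom (α := abelianPGroup p lam) (p ^ j)).ker =
      p ^ ∑ i, min j (lam i) := by
    have h3 : Nat.card {x : abelianPGroup p lam // ∀ i, p ^ j • x i = 0} =
        p ^ ∑ i, min j (lam i) := by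
      rw [Nat.card_congr (Equiv.subtypePiEquivPi (p := fun i (x : ZMod (p ^ lam i)) =>
        p ^ j • x = 0)), Nat.card_pi]
      simp only [ZMod.card_nsmul_ker, Finset.prod_pow_eq_pow_sum]
    rw [← h3]
    refine Nat.card_congr (Equiv.subtypeEquivRight fun x => ?_)
    rw [AddMonoidHom.mem_ker]
    exact funext_iff
  rw [top_inf_eq, h2, AddSubgroup.card_top, card_abelianPGroup] at h1
  refine Nat.eq_of_mul_eq_mul_right (pow_pos hp.out.pos (∑ i, min j (lam i))) ?_
  rw [h1, ← pow_add, ← Finset.sum_add_distrib, size]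
  congr 1
  exact Finset.sum_congr rfl fun i _ => by omega

/-- The p-torsion of p^j G has order |p^j G| / |p^(j+1) G|, and λ_i contributes a factor p to this
quotient exactly when j < λ_i. -/
theorem card_map_pow_inf_ker_abelianPGroup (j : ℕ) :
    Nat.card ((⊤ : AddSubgroup (abelianPGroup p lam)).map (nsmulAddMonoidHom (p ^ j)) ⊓
      (nsmulAddMonoidHom p).ker : AddSubgroup (abelianPGroup p lam)) = p ^ colHeight lam j := by
  have h1 := AddSubgroup.card_map_mul_card_inf_ker
    (nsmulAddMonoidHom (α := abelianPGroup p lam) p)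
    ((⊤ : AddSubgroup (abelianPGroup p lam)).map (nsmulAddMonoidHom (p ^ j)))
  have h2 : ((⊤ : AddSubgroup (abelianPGroup p lam)).map (nsmulAddMonoidHom (p ^ j))).map
      (nsmulAddMonoidHom p) = (⊤ : AddSubgroup (abelianPGroup p lam)).map
        (nsmulAddMonoidHom (p ^ (j + 1))) := by
    rw [AddSubgroup.map_map]
    congr 1
    ext x
    simp [mul_smul, pow_succ']
  rw [h2, card_map_pow_abelianPGroup, card_map_pow_abelianPGroup] at h1
  refine Nat.eq_of_mul_eq_mul_left (pow_pos hp.out.pos (∑ i, (lam i - (j + 1)))) ?_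
  rw [h1, ← pow_add, colHeight, Finset.card_filter, ← Finset.sum_add_distrib]
  congr 1
  refine Finset.sum_congr rfl fun i _ => ?_
  split_ifs <;> omega

/-- The number of subgroups of order `p ^ k` of `G_λ`, as a polynomial in `p`. -/
noncomputable def countPoly (k : ℕ) : ℤ[X] :=
  ∑ r ∈ range (n + 1), subPoly (size lam) (colHeight lam) k r

theorem eval_countPoly (k : ℕ) :
    (countPoly lam k).eval (p : ℤ) = (subgroupCount p lam k : ℤ) := by
  have hpinj := Nat.pow_right_injective hp.out.two_le
  rw [subgroupCount, Nat.card_subtype_eq_sum (range (n + 1)) _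
    (fun r (H : AddSubgroup (abelianPGroup p lam)) =>
      Nat.card (H ⊓ (nsmulAddMonoidHom p).ker : AddSubgroup (abelianPGroup p lam)) = p ^ r)]
  · rw [countPoly, eval_finsetSum, Nat.cast_sum]
    refine Finset.sum_congr rfl fun r _ => ?_
    rw [← card_subgroups_eq_subPoly (size lam) (⊤ : AddSubgroup (abelianPGroup p lam))
      (colHeight lam) k r ?_ (card_map_pow_inf_ker_abelianPGroup lam p)]
    · congr 1
      exact Nat.card_congr (Equiv.subtypeEquivRight fun H => by simp)
    · rw [← AddSubgroup.card_eq_one, card_map_pow_abelianPGroup]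
      have : ∀ i, lam i - size lam = 0 := fun i =>
        Nat.sub_eq_zero_of_le (Finset.single_le_sum (f := lam) (fun _ _ => Nat.zero_le _)
          (mem_univ i))
      simp [this]
  · intro H hH
    have h5 := AddSubgroup.card_dvd_of_le (inf_le_left : H ⊓ (nsmulAddMonoidHom p).ker ≤ H)
    rw [hH, Nat.dvd_prime_pow hp.out] at h5
    obtain ⟨r, -, hr⟩ := h5
    refine ⟨r, ?_, hr⟩
    have h6 := AddSubgroup.card_le_of_le (le_inf (le_top.trans_eq (by
      ext x; simp)) inf_le_right : H ⊓ (nsmulAddMonoidHom p).ker ≤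
        (⊤ : AddSubgroup (abelianPGroup p lam)).map (nsmulAddMonoidHom (p ^ 0)) ⊓
          (nsmulAddMonoidHom p).ker)
    rw [card_map_pow_inf_ker_abelianPGroup, hr, Nat.pow_le_pow_iff_right hp.out.two_le] at h6
    have h7 : colHeight lam 0 ≤ n := (Finset.card_filter_le _ _).trans (by simp)
    exact mem_range.2 (by omega)
  · intro H s s' h1 h2
    exact hpinj (h1.symm.trans h2)

end

/-- By duality the two polynomials agree at every prime, hence at infinitely many points. -/
theorem countPoly_symm {n : ℕ} (lam : Fin n → ℕ) {k : ℕ} (hk : k ≤ size lam) :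
    countPoly lam (size lam - k) = countPoly lam k := by
  refine Polynomial.eq_of_infinite_eval_eq _ _ (Set.Infinite.mono ?_
    (Nat.infinite_setOfPred_prime.image Nat.cast_injective.injOn : Set.Infinite
      ((fun p : ℕ => (p : ℤ)) '' {p | p.Prime})))
  rintro _ ⟨p, hp, rfl⟩
  have : Fact p.Prime := ⟨hp⟩
  simp only [Set.mem_ofPred_eq]
  rw [eval_countPoly, eval_countPoly, subgroupCount, subgroupCount,
    AddCommGroup.card_addSubgroup_eq_of_card_eq_mul (b := p ^ k)]
  rw [card_abelianPGroup, ← pow_add]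
  congr 1
  omega

/-! ### Degrees of the local factors -/

theorem gauss_eq_zero : ∀ {m r : ℕ}, m < r → gauss m r = 0
  | 0, _ + 1, _ => rfl
  | m + 1, r + 1, h => by
    have h1 : gauss (m + 1) (r + 1) = gauss m r + X ^ (r + 1) * gauss m (r + 1) := rfl
    rw [h1, gauss_eq_zero (by omega : m < r), gauss_eq_zero (by omega : m < r + 1)]
    simp

theorem gauss_monic_natDegree (m : ℕ) :
    ∀ r ≤ m, (gauss m r).Monic ∧ (gauss m r).natDegree = r * (m - r) := by
  have h0 : ∀ m, gauss m 0 = 1 := fun m => by cases m <;> rfl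
  induction m with
  | zero =>
    intro r hr
    obtain rfl : r = 0 := by omega
    simp [h0, monic_one]
  | succ m ih =>
    intro r hr
    rcases r with _ | r
    · simp [h0, monic_one]
    have h1 : gauss (m + 1) (r + 1) = gauss m r + X ^ (r + 1) * gauss m (r + 1) := rfl
    obtain ⟨hm, hd⟩ := ih r (by omega)
    rcases Nat.lt_or_ge m (r + 1) with h | h
    · obtain rfl : r = m := by omega
      rw [h1, gauss_eq_zero h, mul_zero, add_zero]
      exact ⟨hm, by rw [hd]; simp⟩
    · obtain ⟨hm', hd'⟩ := ih (r + 1) h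
      have hq : (X ^ (r + 1) * gauss m (r + 1) : ℤ[X]).Monic := (monic_X_pow _).mul hm'
      have hqd : (X ^ (r + 1) * gauss m (r + 1) : ℤ[X]).natDegree = (r + 1) * (m - r) := by
        rw [(monic_X_pow _).natDegree_mul hm', natDegree_X_pow, hd']
        obtain ⟨d, rfl⟩ := Nat.exists_eq_add_of_le h
        rw [show r + 1 + d - (r + 1) = d by omega, show r + 1 + d - r = d + 1 by omega]
        ring
      -- The summands of Pascal's rule have degrees r(m-r) and (r+1)(m-r), so the second dominates.
      have hlt : (gauss m r).degree < (X ^ (r + 1) * gauss m (r + 1) : ℤ[X]).degree := by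
        rw [degree_eq_natDegree hm.ne_zero, degree_eq_natDegree hq.ne_zero, hd, hqd,
          Nat.cast_lt]
        have : 0 < m - r := by omega
        nlinarith
      rw [h1]
      refine ⟨hq.add_of_right hlt, ?_⟩
      rw [natDegree_add_eq_right_of_degree_lt hlt, hqd]
      simp

/-- `r` is one of the two integers closest to `x / 2`. -/
def IsNearHalf (r x : ℕ) : Prop := 2 * r ≤ x + 1 ∧ x ≤ 2 * r + 1

/-- With x = m - l, the right side minus the left is (y-r)² for x = 2y and (y-r)(y+1-r) for x =
2y+1. Both are nonnegative at integers and vanish only at the integers nearest to x/2. If l > m,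
equality forces r = 0, in accordance with the truncated difference. -/
theorem mul_sub_le_and_eq_iff {r m : ℕ} (l : ℕ) (hr : r ≤ m) :
    r * (m - r) ≤ l * r + (m - l) / 2 * ((m - l + 1) / 2) ∧
      (r * (m - r) = l * r + (m - l) / 2 * ((m - l + 1) / 2) ↔ IsNearHalf r (m - l)) := by
  unfold IsNearHalf
  obtain ⟨d, rfl⟩ := Nat.exists_eq_add_of_le hr
  rw [Nat.add_sub_cancel_left]
  rcases le_or_gt l (r + d) with h | h
  · obtain ⟨x, hx⟩ := Nat.exists_eq_add_of_le h
    rw [hx, Nat.add_sub_cancel_left]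
    have hd : (d : ℤ) = l + x - r := by
      have : ((r + d : ℕ) : ℤ) = ((l + x : ℕ) : ℤ) := by rw [hx]
      push_cast at this
      linarith
    rcases Nat.even_or_odd' x with ⟨y, rfl | rfl⟩
    · rw [show 2 * y / 2 = y by omega, show (2 * y + 1) / 2 = y by omega]
      have key : (l * r + y * y : ℤ) - r * d = (y - r) ^ 2 := by
        rw [hd]; push_cast; ring
      zify
      constructor
      · nlinarith [sq_nonneg ((y : ℤ) - r)]
      · constructor
        · intro h
          have : ((y : ℤ) - r) ^ 2 = 0 := by linarith
          have : (y : ℤ) - r = 0 := by simpa using this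
          omega
        · intro h
          have : (y : ℤ) = r := by omega
          rw [this] at key
          simp only [sub_self, ne_eq, OfNat.ofNat_ne_zero, not_false_eq_true, zero_pow] at key
          rw [this]
          linarith
    · rw [show (2 * y + 1) / 2 = y by omega, show (2 * y + 1 + 1) / 2 = y + 1 by omega]
      have key : (l * r + y * (y + 1) : ℤ) - r * d = (y - r) * (y + 1 - r) := by
        rw [hd]; push_cast; ring
      have hnn : (0 : ℤ) ≤ (y - r) * (y + 1 - r) := by
        rcases le_or_gt (r : ℤ) y with h | h
        · exact mul_nonneg (by linarith) (by linarith)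
        · exact mul_nonneg_of_nonpos_of_nonpos (by linarith) (by linarith)
      zify
      constructor
      · linarith
      · constructor
        · intro h
          have : ((y : ℤ) - r) * (y + 1 - r) = 0 := by linarith
          rcases mul_eq_zero.1 this with h | h <;> omega
        · intro h
          have : (y : ℤ) - r = 0 ∨ (y : ℤ) + 1 - r = 0 := by omega
          have : ((y : ℤ) - r) * (y + 1 - r) = 0 := mul_eq_zero.2 this
          linarith
  · rw [show r + d - l = 0 by omega]
    simp only [Nat.zero_div, zero_mul, add_zero]
    constructor
    · rw [mul_comm]
      exact Nat.mul_le_mul_right r (by omega)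
    · constructor
      · intro h'
        rw [mul_comm] at h'
        rcases Nat.eq_zero_or_pos r with h0 | h0
        · omega
        · have := Nat.eq_of_mul_eq_mul_right h0 h'
          omega
      · intro h'
        obtain rfl : r = 0 := by omega
        simp

/-! ### Rows, columns and interlacing tuples -/

/-- The length of the row with index `i` of the diagram whose first `e` columns are `m`. -/
def rows (e : ℕ) (m : ℕ → ℕ) (i : ℕ) : ℕ := #{j ∈ range e | i ≤ m j}

theorem rows_zero (m : ℕ → ℕ) (i : ℕ) : rows 0 m i = 0 := rfl

theorem rows_succ (e : ℕ) (m : ℕ → ℕ) (i : ℕ) :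
    rows (e + 1) m i = (if i ≤ m 0 then 1 else 0) + rows e (fun j => m (j + 1)) i := by
  simp only [rows, Finset.card_filter]
  rw [Finset.sum_range_succ', add_comm]

theorem rows_eq_zero {e : ℕ} {m : ℕ → ℕ} {i : ℕ} (h : ∀ j, m j < i) : rows e m i = 0 := by
  rw [rows, Finset.card_eq_zero, Finset.filter_eq_empty_iff]
  intro j _
  exact not_le.2 (h j)

theorem rows_antitone (e : ℕ) (m : ℕ → ℕ) : Antitone (rows e m) := fun _ _ h =>
  Finset.card_le_card (Finset.monotone_filter_right _ fun _ _ h' => h.trans h')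

/-- The tuples `t` with `f (2 i) ≤ t_i ≤ f (2 i - 1)` for `1 ≤ i ≤ M`. -/
def rowBox (M : ℕ) (f : ℕ → ℕ) : Finset (Fin M → ℕ) :=
  Fintype.piFinset fun i => Icc (f (2 * i + 2)) (f (2 * i + 1))

theorem mem_rowBox {M : ℕ} {f : ℕ → ℕ} {t : Fin M → ℕ} :
    t ∈ rowBox M f ↔ ∀ i : Fin M, f (2 * i + 2) ≤ t i ∧ t i ≤ f (2 * i + 1) := by
  simp only [rowBox, Fintype.mem_piFinset, mem_Icc]

theorem antitone_of_mem_rowBox {M : ℕ} {f : ℕ → ℕ} (hf : Antitone f) {t : Fin M → ℕ}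
    (ht : t ∈ rowBox M f) : Antitone t := by
  intro i j hij
  rcases hij.eq_or_lt with rfl | hlt
  · exact le_rfl
  · have h1 := (mem_rowBox.1 ht j).2
    have h2 := (mem_rowBox.1 ht i).1
    have h3 : f (2 * j + 1) ≤ f (2 * i + 2) := hf (by have := Fin.lt_def.1 hlt; omega)
    exact h1.trans (h3.trans h2)

theorem pos_iff_lt_card_support {M : ℕ} {t : Fin M → ℕ} (ht : Antitone t) (i : Fin M) :
    0 < t i ↔ (i : ℕ) < #{i | 0 < t i} := by
  constructor
  · intro h
    have h1 : Finset.Iic i ⊆ ({i | 0 < t i} : Finset (Fin M)) := fun j hj =>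
      mem_filter.2 ⟨mem_univ _, h.trans_le (ht (mem_Iic.1 hj))⟩
    have h2 := Finset.card_le_card h1
    rw [Fin.card_Iic] at h2
    omega
  · intro h
    by_contra h0
    have h1 : ({i | 0 < t i} : Finset (Fin M)) ⊆ Finset.Iio i := fun j hj => by
      rw [mem_Iio]
      by_contra hij
      exact h0 ((mem_filter.1 hj).2.trans_le (ht (not_lt.1 hij)))
    have h2 := Finset.card_le_card h1
    rw [Fin.card_Iio] at h2
    omega

/-- The number of tuples in a rowBox with given sum and given size of the support. -/
def boxCount (M : ℕ) (f : ℕ → ℕ) (k r : ℕ) : ℕ :=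
  #{t ∈ rowBox M f | ∑ i, t i = k ∧ #{i | 0 < t i} = r}

theorem card_filter_lt_fin {M r : ℕ} (h : r ≤ M) : #{i : Fin M | (i : ℕ) < r} = r := by
  rw [Fin.card_filter_val_lt, min_eq_right h]

theorem boxCount_rows_zero (M : ℕ) (m : ℕ → ℕ) (l k r : ℕ) :
    boxCount M (fun i => rows 0 m (i + l)) k r = if k = 0 ∧ r = 0 then 1 else 0 := by
  have : rowBox M (fun i => rows 0 m (i + l)) = {fun _ => 0} := by
    ext t
    rw [mem_rowBox, mem_singleton, funext_iff]
    simp [rows_zero]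
  rw [boxCount, this, Finset.filter_singleton]
  simp only [sum_const_zero, lt_self_iff_false, filter_false, card_empty]
  split_ifs with h1 h2 h2
  · simp
  · exact absurd ⟨h1.1.symm, h1.2.symm⟩ h2
  · exact absurd ⟨h2.1.symm, h2.2.symm⟩ h1
  · simp

/-- Deleting the first column of the diagram of `t` subtracts 1 from its `r` positive entries. The
inverse adds 1 to the first `r` entries, which requires that the remaining tuple have at most `r`
positive entries; hence the sum over s ≤ r. The bounds force t_i > 0 when 2i + l ≤ m_0 and t_i = 0
when 2i - 1 + l > m_0, which means that `r` is near (m_0 - l)/2. -/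
theorem boxCount_rows_succ {M e l : ℕ} {m : ℕ → ℕ} (hm : Antitone m) (hM : m 0 ≤ 2 * M + l)
    (k r : ℕ) [Decidable (r ≤ k ∧ IsNearHalf r (m 0 - l))] :
    boxCount M (fun i => rows (e + 1) m (i + l)) k r =
      if r ≤ k ∧ IsNearHalf r (m 0 - l) then
        ∑ s ∈ range (r + 1), boxCount M (fun i => rows e (fun j => m (j + 1)) (i + l)) (k - r) s
      else 0 := by
  set m' : ℕ → ℕ := fun j => m (j + 1) with hm'
  have hrs : ∀ i, rows (e + 1) m i = (if i ≤ m 0 then 1 else 0) + rows e m' i := rows_succ e m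
  have hanti : ∀ e m, Antitone fun i => rows e m (i + l) := fun e m i j hij =>
    rows_antitone e m (by omega)
  have hz' : ∀ i, m 0 < i → rows e m' i = 0 := fun i hi =>
    rows_eq_zero fun j => (hm (Nat.zero_le (j + 1))).trans_lt hi
  have hz : ∀ i, m 0 < i → rows (e + 1) m i = 0 := fun i hi =>
    rows_eq_zero fun j => (hm (Nat.zero_le j)).trans_lt hi
  split_ifs with h
  · obtain ⟨hrk, hb1, hb2⟩ := h
    have hS : ∑ s ∈ range (r + 1), boxCount M (fun i => rows e m' (i + l)) (k - r) s =
        #{t ∈ rowBox M (fun i => rows e m' (i + l)) |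
          ∑ i, t i = k - r ∧ #{i | 0 < t i} ≤ r} := by
      rw [Finset.card_eq_sum_card_fiberwise (f := fun t : Fin M → ℕ => #{i | 0 < t i})
        (t := range (r + 1))]
      · refine Finset.sum_congr rfl fun s hs => ?_
        have hs' := mem_range.1 hs
        rw [boxCount, Finset.filter_filter]
        congr 1
        refine Finset.filter_congr fun t _ => ?_
        constructor
        · rintro ⟨h1, h2⟩
          exact ⟨⟨h1, by omega⟩, h2⟩
        · rintro ⟨⟨h1, -⟩, h2⟩
          exact ⟨h1, h2⟩
      · intro t ht
        exact mem_coe.2 (mem_range.2 (Nat.lt_succ_of_le (mem_filter.1 ht).2.2))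
    rw [hS, boxCount]
    have hrM : r ≤ M := by omega
    refine Finset.card_nbij' (fun t i => t i - 1) (fun t i => t i + if (i : ℕ) < r then 1 else 0)
      ?_ ?_ ?_ ?_
    · intro t ht
      obtain ⟨ht1, ht2, ht3⟩ := mem_filter.1 (mem_coe.1 ht)
      refine mem_coe.2 (mem_filter.2 ⟨mem_rowBox.2 fun i => ?_, ?_, ?_⟩)
      · obtain ⟨h1, h2⟩ := mem_rowBox.1 ht1 i
        simp only [hrs] at h1 h2
        constructor
        · rcases le_or_gt (2 * (i : ℕ) + 2 + l) (m 0) with h | h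
          · rw [if_pos h] at h1
            change rows e m' _ ≤ t i - 1
            omega
          · change rows e m' _ ≤ t i - 1
            rw [hz' _ h]
            exact Nat.zero_le _
        · change t i - 1 ≤ rows e m' _
          split_ifs at h2 <;> omega
      · have h4 : ∑ i, (t i - 1) + #{i | 0 < t i} = ∑ i, t i := by
          rw [Finset.card_filter, ← Finset.sum_add_distrib]
          refine Finset.sum_congr rfl fun i _ => ?_
          split_ifs <;> omega
        rw [ht3, ht2] at h4
        change ∑ i, (t i - 1) = k - r
        omega
      · rw [← ht3]
        exact Finset.card_le_card (Finset.monotone_filter_right _ fun i _ (hi : 0 < t i - 1) => by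
          omega)
    · intro t ht
      obtain ⟨ht1, ht2, ht3⟩ := mem_filter.1 (mem_coe.1 ht)
      have hpos := pos_iff_lt_card_support (antitone_of_mem_rowBox (hanti e m') ht1)
      have hsupp : ∀ i : Fin M, (0 < t i + if (i : ℕ) < r then 1 else 0) ↔ (i : ℕ) < r := by
        intro i
        have := hpos i
        split_ifs with h <;> omega
      refine mem_coe.2 (mem_filter.2 ⟨mem_rowBox.2 fun i => ?_, ?_, ?_⟩)
      · obtain ⟨h1, h2⟩ := mem_rowBox.1 ht1 i
        have := hpos i
        have h3 := hsupp i
        constructor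
        · change rows (e + 1) m (2 * i + 2 + l) ≤ t i + if (i : ℕ) < r then 1 else 0
          rcases lt_or_ge (i : ℕ) r with h | h
          · rw [if_pos h, hrs]
            split_ifs <;> omega
          · rw [hz _ (by omega)]
            exact Nat.zero_le _
        · change (t i + if (i : ℕ) < r then 1 else 0) ≤ rows (e + 1) m (2 * i + 1 + l)
          rw [hrs]
          rcases lt_or_ge (i : ℕ) r with h | h
          · rw [if_pos h, if_pos (by omega)]
            omega
          · rw [if_neg (by omega)]
            omega
      · change ∑ i : Fin M, (t i + if (i : ℕ) < r then 1 else 0) = k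
        rw [Finset.sum_add_distrib, ← Finset.card_filter, card_filter_lt_fin hrM, ht2]
        omega
      · change #{i : Fin M | 0 < t i + if (i : ℕ) < r then 1 else 0} = r
        simp only [hsupp]
        exact card_filter_lt_fin hrM
    · intro t ht
      obtain ⟨ht1, ht2, ht3⟩ := mem_filter.1 (mem_coe.1 ht)
      have hpos := pos_iff_lt_card_support (antitone_of_mem_rowBox (hanti (e + 1) m) ht1)
      funext i
      have := hpos i
      rw [ht3] at this
      change (t i - 1 + if (i : ℕ) < r then 1 else 0) = t i
      split_ifs with h <;> omega
    · intro t ht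
      obtain ⟨ht1, ht2, ht3⟩ := mem_filter.1 (mem_coe.1 ht)
      have hpos := pos_iff_lt_card_support (antitone_of_mem_rowBox (hanti e m') ht1)
      funext i
      have := hpos i
      change (t i + if (i : ℕ) < r then 1 else 0) - 1 = t i
      split_ifs with h <;> omega
  · rw [boxCount, Finset.card_eq_zero, Finset.filter_eq_empty_iff]
    rintro t ht ⟨h1, h2⟩
    refine h ⟨?_, ?_, ?_⟩
    · rw [← h1, ← h2, Finset.card_filter]
      refine Finset.sum_le_sum fun i _ => ?_
      split_ifs <;> omega
    · have h3 : #{i | 0 < t i} ≤ #{i : Fin M | (i : ℕ) < (m 0 - l + 1) / 2} := by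
        refine Finset.card_le_card (Finset.monotone_filter_right _ fun i _ hi => ?_)
        by_contra h4
        have h5 := (mem_rowBox.1 ht i).2
        rw [hz _ (by omega)] at h5
        omega
      rw [h2, card_filter_lt_fin (by omega)] at h3
      omega
    · have h3 : #{i : Fin M | (i : ℕ) < (m 0 - l) / 2} ≤ #{i | 0 < t i} := by
        refine Finset.card_le_card (Finset.monotone_filter_right _ fun i _ hi => ?_)
        have h5 := (mem_rowBox.1 ht i).1
        rw [hrs, if_pos (by omega)] at h5
        omega
      rw [h2, card_filter_lt_fin (by omega)] at h3
      omega

/-- The degree of `subPoly e m k r` is at most `l * k + quarterSum e m l`. -/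
def quarterSum (e : ℕ) (m : ℕ → ℕ) (l : ℕ) : ℕ :=
  ∑ j ∈ range e, (m j - l) / 2 * ((m j - l + 1) / 2)

/-- The recursions for `subPoly` and for `boxCount` both delete the first column. Only ranks near
half of m_0 - l reach the degree bound, and the factors there are monic, so the coefficient obeys
the recursion of the box count. -/
theorem subPoly_natDegree_le_and_coeff {M l : ℕ} (e : ℕ) :
    ∀ m : ℕ → ℕ, Antitone m → m 0 ≤ 2 * M + l → ∀ k r : ℕ,
      (subPoly e m k r).natDegree ≤ l * k + quarterSum e m l ∧
      (subPoly e m k r).coeff (l * k + quarterSum e m l) =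
        boxCount M (fun i => rows e m (i + l)) k r := by
  classical
  induction e with
  | zero =>
    intro m _ _ k r
    rw [boxCount_rows_zero, subPoly]
    split_ifs with h
    · simp [h.1, quarterSum]
    · simp
  | succ e ih =>
    intro m hm hM k r
    rw [boxCount_rows_succ hm hM, subPoly]
    have hq : quarterSum (e + 1) m l =
        quarterSum e (fun j => m (j + 1)) l + (m 0 - l) / 2 * ((m 0 - l + 1) / 2) :=
      Finset.sum_range_succ' _ _
    rcases em (r ≤ k ∧ r ≤ m 0) with h | h
    swap
    · rw [if_neg h, if_neg]
      · simp
      · rintro ⟨h1, h2, h3⟩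
        exact h ⟨h1, by omega⟩
    rw [if_pos h]
    obtain ⟨hrk, hrm⟩ := h
    obtain ⟨hle, heq⟩ := mul_sub_le_and_eq_iff l hrm
    have hlk : l * (k - r) + l * r = l * k := by
      rw [← mul_add]
      congr 1
      omega
    -- The factor has degree s(m_0-r) + (r-s)(m_0-r) = r(m_0-r), independent of s, so no term of the
    -- sum dominates another a priori.
    have hterm : ∀ s ∈ range (r + 1),
        (subPoly e (fun j => m (j + 1)) (k - r) s *
          (X ^ (s * (m 0 - r)) * gauss (m 0 - s) (r - s))).natDegree ≤
            l * (k - r) + quarterSum e (fun j => m (j + 1)) l + r * (m 0 - r) ∧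
        (subPoly e (fun j => m (j + 1)) (k - r) s *
          (X ^ (s * (m 0 - r)) * gauss (m 0 - s) (r - s))).coeff
            (l * (k - r) + quarterSum e (fun j => m (j + 1)) l + r * (m 0 - r)) =
          (boxCount M (fun i => rows e (fun j => m (j + 1)) (i + l)) (k - r) s : ℤ) := by
      intro s hs
      have hsr : s ≤ r := Nat.lt_succ_iff.1 (mem_range.1 hs)
      obtain ⟨h1, h2⟩ := ih (fun j => m (j + 1)) (fun i j hij => hm (by omega))
        ((hm (Nat.zero_le 1)).trans hM) (k - r) s
      obtain ⟨hg, hgd⟩ := gauss_monic_natDegree (m 0 - s) (r - s) (by omega)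
      have hQ : (X ^ (s * (m 0 - r)) * gauss (m 0 - s) (r - s) : ℤ[X]).Monic :=
        (monic_X_pow _).mul hg
      have hQd : (X ^ (s * (m 0 - r)) * gauss (m 0 - s) (r - s) : ℤ[X]).natDegree =
          r * (m 0 - r) := by
        rw [(monic_X_pow _).natDegree_mul hg, natDegree_X_pow, hgd,
          show m 0 - s - (r - s) = m 0 - r by omega, ← add_mul]
        congr 1
        omega
      refine ⟨natDegree_mul_le_of_le h1 hQd.le, ?_⟩
      rw [coeff_mul_add_eq_of_natDegree_le h1 hQd.le, h2]
      have : (X ^ (s * (m 0 - r)) * gauss (m 0 - s) (r - s) : ℤ[X]).coeff (r * (m 0 - r)) = 1 := by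
        rw [← hQd]
        exact hQ
      rw [this, mul_one]
    have hD : l * (k - r) + quarterSum e (fun j => m (j + 1)) l + r * (m 0 - r) ≤
        l * k + quarterSum (e + 1) m l := by
      rw [hq]
      omega
    refine ⟨natDegree_sum_le_of_forall_le _ _ fun s hs => ((hterm s hs).1).trans hD, ?_⟩
    rw [finsetSum_coeff]
    split_ifs with hb
    · have hDeq : l * (k - r) + quarterSum e (fun j => m (j + 1)) l + r * (m 0 - r) =
          l * k + quarterSum (e + 1) m l := by
        have := heq.2 hb.2
        rw [hq]
        omega
      rw [Nat.cast_sum]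
      refine Finset.sum_congr rfl fun s hs => ?_
      rw [← hDeq, (hterm s hs).2]
    · refine Finset.sum_eq_zero fun s hs => ?_
      apply coeff_eq_zero_of_natDegree_lt
      refine (hterm s hs).1.trans_lt (lt_of_le_of_ne hD fun h => hb ⟨hrk, heq.1 ?_⟩)
      rw [hq] at h
      omega

/-! ### Symmetry and unimodality of the tuple count -/

/-- The number of tuples `t` with `f (2 i) ≤ t_i ≤ f (2 i - 1)` for `1 ≤ i ≤ M` and sum `k`. -/
def pairCount : ℕ → (ℕ → ℕ) → ℤ → ℕ
  | 0, _, k => if k = 0 then 1 else 0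
  | M + 1, f, k => ∑ t ∈ Icc (f 2) (f 1), pairCount M (fun i => f (i + 2)) (k - t)

/-- Only indices from 1 on matter. This excludes the default `part lam 0 = 0`, which would break
monotonicity and differs from row 0 of the diagram. -/
theorem pairCount_congr (M : ℕ) :
    ∀ {f g : ℕ → ℕ}, (∀ i, 1 ≤ i → f i = g i) → pairCount M f = pairCount M g := by
  induction M with
  | zero => intros; rfl
  | succ M ih =>
    intro f g h
    funext k
    rw [pairCount, pairCount, h 1 le_rfl, h 2 (by omega),
      ih (f := fun i => f (i + 2)) (g := fun i => g (i + 2)) fun i _ => h _ (by omega)]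

theorem pairCount_of_zero (M : ℕ) :
    ∀ {f : ℕ → ℕ}, (∀ i, 1 ≤ i → f i = 0) → ∀ k, pairCount M f k = if k = 0 then 1 else 0 := by
  induction M with
  | zero => intros; rfl
  | succ M ih =>
    intro f h k
    rw [pairCount, h 1 le_rfl, h 2 (by omega), Icc_self, sum_singleton,
      ih (f := fun i => f (i + 2)) fun i _ => h _ (by omega)]
    simp

theorem card_filter_rowBox (M : ℕ) : ∀ (f : ℕ → ℕ) (k : ℤ),
    #{t ∈ rowBox M f | ∑ i, (t i : ℤ) = k} = pairCount M f k := by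
  induction M with
  | zero =>
    intro f k
    have : rowBox 0 f = univ := by
      ext t
      exact iff_of_true (mem_rowBox.2 fun i => i.elim0) (mem_univ _)
    rw [this, pairCount]
    split_ifs with h
    · simp [h]
    · simp [Ne.symm h]
  | succ M ih =>
    intro f k
    rw [pairCount, Finset.card_eq_sum_card_fiberwise (f := fun t : Fin (M + 1) → ℕ => t 0)
      (t := Icc (f 2) (f 1))]
    · refine Finset.sum_congr rfl fun a ha => ?_
      rw [← ih]
      refine Finset.card_nbij' (fun t => Fin.tail t)
        (fun t => (Fin.cons a t : Fin (M + 1) → ℕ)) ?_ ?_ ?_ ?_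
      · intro t ht
        simp only [coe_filter, mem_filter, Set.mem_ofPred_eq, mem_rowBox, Fin.forall_fin_succ,
          Fin.sum_univ_succ] at ht ⊢
        obtain ⟨⟨⟨-, h1⟩, h2⟩, h3⟩ := ht
        refine ⟨fun i => ?_, ?_⟩
        · have := h1 i
          rw [Fin.val_succ] at this
          exact this
        · simp only [Fin.tail]
          rw [← h2, h3]
          ring
      · intro t ht
        simp only [coe_filter, mem_filter, Set.mem_ofPred_eq, mem_rowBox, Fin.forall_fin_succ,
          Fin.sum_univ_succ, Fin.cons_zero, Fin.cons_succ] at ht ⊢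
        refine ⟨⟨⟨mem_Icc.1 ha, fun i => ?_⟩, ?_⟩, trivial⟩
        · rw [Fin.val_succ]
          exact ht.1 i
        · rw [ht.2]
          ring
      · intro t ht
        have h : t 0 = a := by simpa using (mem_filter.1 (mem_coe.1 ht)).2
        simp only
        rw [← h, Fin.cons_self_tail]
      · intro t _
        simp
    · intro t ht
      exact mem_coe.2 (mem_Icc.2 (mem_rowBox.1 (mem_filter.1 ht).1 0))

/-- `f` is symmetric with respect to `s / 2` and decreases with the distance from `s / 2`. -/
def SymmUnimodal (f : ℤ → ℕ) (s : ℤ) : Prop := ∀ x y : ℤ, |2 * y - s| ≤ |2 * x - s| → f x ≤ f y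

theorem SymmUnimodal.symm {f : ℤ → ℕ} {s : ℤ} (h : SymmUnimodal f s) (x : ℤ) :
    f (s - x) = f x := by
  have : |2 * x - s| = |2 * (s - x) - s| := by
    rw [← abs_neg]
    congr 1
    ring
  exact le_antisymm (h _ _ this.le) (h _ _ this.ge)

/-- Reflection moves both points into the half line left of s/2, where the steps chain together. -/
theorem symmUnimodal_of_step {f : ℤ → ℕ} {s : ℤ} (hsymm : ∀ x, f (s - x) = f x)
    (hstep : ∀ x, 2 * x + 1 ≤ s → f x ≤ f (x + 1)) : SymmUnimodal f s := by
  have hmono : ∀ (d : ℕ) (x : ℤ), 2 * (x + d) ≤ s → f x ≤ f (x + d) := by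
    intro d
    induction d with
    | zero => intro x _; simp
    | succ d ih =>
      intro x hx
      push_cast at hx ⊢
      rw [← add_assoc]
      exact (ih x (by linarith)).trans (hstep _ (by linarith))
  have hmono' : ∀ x y : ℤ, x ≤ y → 2 * y ≤ s → f x ≤ f y := by
    intro x y hxy hy
    obtain ⟨d, rfl⟩ := Int.le.dest hxy
    exact hmono d x hy
  intro x y hxy
  obtain ⟨x', hx', hfx⟩ : ∃ x', 2 * x' - s = -|2 * x - s| ∧ f x' = f x := by
    rcases abs_cases (2 * x - s) with h | h
    · exact ⟨s - x, by rw [h.1]; ring, hsymm x⟩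
    · exact ⟨x, by rw [h.1]; ring, rfl⟩
  obtain ⟨y', hy', hfy⟩ : ∃ y', 2 * y' - s = -|2 * y - s| ∧ f y' = f y := by
    rcases abs_cases (2 * y - s) with h | h
    · exact ⟨s - y, by rw [h.1]; ring, hsymm y⟩
    · exact ⟨y, by rw [h.1]; ring, rfl⟩
  rw [← hfx, ← hfy]
  have := abs_nonneg (2 * y - s)
  exact hmono' x' y' (by linarith) (by linarith)

/-- Moving the window by one gains f(k+1-a) and loses f(k-b). Left of the new centre, the gained
point is at least as close to s/2 as the lost one. -/
theorem SymmUnimodal.sum_window {f : ℤ → ℕ} {s : ℤ} (h : SymmUnimodal f s) {a b : ℕ}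
    (hab : a ≤ b) : SymmUnimodal (fun k => ∑ t ∈ Icc a b, f (k - t)) (s + a + b) := by
  have hsum : ∀ k : ℤ, ∑ t ∈ Icc a b, f (k - t) = ∑ t ∈ Icc a b, f (k - a - b + t) := by
    intro k
    refine Finset.sum_nbij' (fun t => a + b - t) (fun t => a + b - t) ?_ ?_ ?_ ?_ ?_
    · intro t ht; rw [mem_Icc] at ht ⊢; omega
    · intro t ht; rw [mem_Icc] at ht ⊢; omega
    · intro t ht; rw [mem_Icc] at ht; omega
    · intro t ht; rw [mem_Icc] at ht; omega
    · intro t ht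
      rw [mem_Icc] at ht
      congr 1
      push_cast [show t ≤ a + b by omega]
      ring
  apply symmUnimodal_of_step
  · intro k
    rw [hsum k]
    refine Finset.sum_congr rfl fun t _ => ?_
    rw [← h.symm]
    congr 1
    ring
  · intro k hk
    have h1 : ∑ t ∈ Icc a b, f (k - t) = f (k - b) + ∑ t ∈ Ico a b, f (k - t) := by
      rw [← Finset.Ico_insert_right hab, Finset.sum_insert (by simp)]
    have h2 : ∑ t ∈ Icc a b, f (k + 1 - t) = f (k + 1 - a) + ∑ t ∈ Ico a b, f (k - t) := by
      rw [← Finset.Ioc_insert_left hab, Finset.sum_insert (by simp)]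
      congr 1
      refine Finset.sum_nbij' (fun t => t - 1) (fun t => t + 1) ?_ ?_ ?_ ?_ ?_
      · intro t ht; rw [mem_Ioc] at ht; rw [mem_Ico]; omega
      · intro t ht; rw [mem_Ico] at ht; rw [mem_Ioc]; omega
      · intro t ht; rw [mem_Ioc] at ht; omega
      · intro t ht; omega
      · intro t ht
        rw [mem_Ioc] at ht
        congr 1
        push_cast [show 1 ≤ t by omega]
        ring
    rw [h1, h2]
    refine Nat.add_le_add_right (h _ _ ?_) _
    have hab' : (a : ℤ) ≤ b := by exact_mod_cast hab
    rw [abs_le]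
    rcases abs_cases (2 * (k - b) - s) with h | h
    · constructor <;> linarith
    · rw [h.1]
      constructor <;> linarith

theorem symmUnimodal_pairCount (M : ℕ) : ∀ {f : ℕ → ℕ}, (∀ i j, 1 ≤ i → i ≤ j → f j ≤ f i) →
    SymmUnimodal (pairCount M f)
      (∑ i ∈ range M, (f (2 * i + 1) : ℤ) + ∑ i ∈ range M, (f (2 * i + 2) : ℤ)) := by
  induction M with
  | zero =>
    intro f _ x y h
    simp only [range_zero, sum_empty, add_zero, sub_zero] at h
    simp only [pairCount]
    split_ifs with h1 h2
    · exact le_rfl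
    · subst h1
      have := abs_nonpos_iff.1 (h.trans_eq (by simp))
      omega
    · exact Nat.zero_le _
    · exact le_rfl
  | succ M ih =>
    intro f hf
    have h := (ih (f := fun i => f (i + 2)) fun i j h1 h2 => hf _ _ (by omega) (by omega)).sum_window
      (hf 1 2 le_rfl (by omega))
    have e1 : ∀ i, 2 * (i + 1) + 1 = 2 * i + 1 + 2 := fun i => by ring
    have e2 : ∀ i, 2 * (i + 1) + 2 = 2 * i + 2 + 2 := fun i => by ring
    have hs : ∑ i ∈ range (M + 1), (f (2 * i + 1) : ℤ) + ∑ i ∈ range (M + 1), (f (2 * i + 2) : ℤ) =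
        ∑ i ∈ range M, (f (2 * i + 1 + 2) : ℤ) + ∑ i ∈ range M, (f (2 * i + 2 + 2) : ℤ) +
          f 2 + f 1 := by
      rw [Finset.sum_range_succ', Finset.sum_range_succ']
      simp only [e1, e2, mul_zero, zero_add]
      ring
    rw [hs]
    exact h

theorem pairCount_eq_zero_of_lt (M : ℕ) : ∀ {f : ℕ → ℕ} {k : ℤ},
    k < ∑ i ∈ range M, (f (2 * i + 2) : ℤ) → pairCount M f k = 0 := by
  induction M with
  | zero =>
    intro f k h
    rw [range_zero, sum_empty] at h
    exact if_neg h.ne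
  | succ M ih =>
    intro f k h
    rw [Finset.sum_range_succ'] at h
    rw [pairCount]
    refine Finset.sum_eq_zero fun t ht => ih ?_
    have h1 : (f 2 : ℤ) ≤ t := by exact_mod_cast (mem_Icc.1 ht).1
    have e2 : ∀ i, 2 * (i + 1) + 2 = 2 * i + 2 + 2 := fun i => by ring
    simp only [mul_zero, zero_add, e2] at h
    linarith

/-- The least possible sum is attained only when every entry equals its lower bound. -/
theorem pairCount_low (M : ℕ) : ∀ {f : ℕ → ℕ}, (∀ i j, 1 ≤ i → i ≤ j → f j ≤ f i) →
    pairCount M f (∑ i ∈ range M, (f (2 * i + 2) : ℤ)) = 1 := by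
  induction M with
  | zero => intro f _; rfl
  | succ M ih =>
    intro f hf
    have e2 : ∀ i, 2 * (i + 1) + 2 = 2 * i + 2 + 2 := fun i => by ring
    rw [pairCount, Finset.sum_range_succ', Finset.sum_eq_single (f 2)]
    · simp only [e2, mul_zero, zero_add]
      rw [add_sub_cancel_right]
      exact ih (f := fun i => f (i + 2)) fun i j h1 h2 => hf _ _ (by omega) (by omega)
    · intro t ht hne
      apply pairCount_eq_zero_of_lt
      have h1 : (f 2 : ℤ) < t := by
        exact_mod_cast lt_of_le_of_ne (mem_Icc.1 ht).1 (Ne.symm hne)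
      simp only [e2, mul_zero, zero_add]
      linarith
    · intro h
      exact absurd (mem_Icc.2 ⟨le_rfl, hf 1 2 le_rfl (by omega)⟩) h

/-! ### The alternating sums c_ℓ and the support of the tuple count -/

theorem part_zero_of_lt {n : ℕ} (lam : Fin n → ℕ) {i : ℕ} (h : n < i) : part lam i = 0 :=
  dif_neg (by omega)

theorem part_antitone {n : ℕ} {lam : Fin n → ℕ} (hlam : Antitone lam) {i j : ℕ} (hi : 1 ≤ i)
    (hij : i ≤ j) : part lam j ≤ part lam i := by
  rcases le_or_gt j n with h | h
  · rw [part, part, dif_pos ⟨by omega, h⟩, dif_pos ⟨hi, by omega⟩]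
    exact hlam (by rw [Fin.mk_le_mk]; omega)
  · rw [part_zero_of_lt lam h]
    exact Nat.zero_le _

theorem part_shift {n : ℕ} (lam : Fin n → ℕ) (l : ℕ) {i : ℕ} (hi : 1 ≤ i) :
    part (shift lam l) i = part lam (i + l) := by
  rcases le_or_gt (i + l) n with h | h
  · rw [part, part, dif_pos ⟨hi, by omega⟩, dif_pos ⟨by omega, h⟩, shift]
    congr 1
    rw [Fin.mk.injEq]
    exact (Nat.sub_add_comm hi).symm
  · rw [part_zero_of_lt _ h, part_zero_of_lt _ (by omega)]

theorem antitone_shift {n : ℕ} {lam : Fin n → ℕ} (hlam : Antitone lam) (l : ℕ) :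
    Antitone (shift lam l) := fun i j hij => hlam (by
  rw [Fin.mk_le_mk]
  exact Nat.add_le_add_right hij l)

theorem cSum_eq_zero {n : ℕ} (lam : Fin n → ℕ) {l : ℕ} (h : n ≤ l) : cSum lam l = 0 := by
  rw [cSum, Icc_eq_empty (by omega), filter_empty, sum_empty]

theorem cSum_eq_add {n : ℕ} (lam : Fin n → ℕ) (l : ℕ) :
    cSum lam l = part lam (l + 1) + cSum lam (l + 2) := by
  rcases Nat.lt_or_ge l n with h | h
  · rw [cSum, cSum]
    have : ({i ∈ Icc (l + 1) n | i % 2 = (l + 1) % 2} : Finset ℕ) =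
        insert (l + 1) {i ∈ Icc (l + 2 + 1) n | i % 2 = (l + 2 + 1) % 2} := by
      ext i
      simp only [mem_filter, mem_Icc, mem_insert]
      omega
    rw [this, sum_insert]
    simp only [mem_filter, mem_Icc]
    omega
  · rw [cSum_eq_zero _ h, cSum_eq_zero _ (by omega), part_zero_of_lt _ (by omega)]

/-- Parts beyond `n` are 0, so any sufficiently large `M` is allowed; this lets M = n serve for
every ℓ. -/
theorem cSum_eq_sum_range (M : ℕ) : ∀ {n : ℕ} (lam : Fin n → ℕ) (l : ℕ), n ≤ 2 * M + l →
    cSum lam l = ∑ i ∈ range M, part lam (2 * i + 1 + l) := by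
  induction M with
  | zero =>
    intro n lam l h
    rw [cSum_eq_zero _ (by omega)]
    rfl
  | succ M ih =>
    intro n lam l h
    rw [cSum_eq_add, ih lam (l + 2) (by omega), Finset.sum_range_succ', add_comm]
    congr 1
    · refine Finset.sum_congr rfl fun i _ => ?_
      congr 1
      ring
    · congr 1
      ring

theorem cSum_succ_eq_sum_range {n M : ℕ} (lam : Fin n → ℕ) (l : ℕ) (h : n ≤ 2 * M + l) :
    cSum lam (l + 1) = ∑ i ∈ range M, part lam (2 * i + 2 + l) := by
  rw [cSum_eq_sum_range M lam (l + 1) (by omega)]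
  refine Finset.sum_congr rfl fun i _ => ?_
  congr 1
  ring

theorem cSum_succ_le {n : ℕ} {lam : Fin n → ℕ} (hlam : Antitone lam) (l : ℕ) :
    cSum lam (l + 1) ≤ cSum lam l := by
  rw [cSum_succ_eq_sum_range (M := n) lam l (by omega), cSum_eq_sum_range n lam l (by omega)]
  exact Finset.sum_le_sum fun i _ => part_antitone hlam (by omega) (by omega)

theorem cSum_shift {n : ℕ} (lam : Fin n → ℕ) (l j : ℕ) :
    cSum (shift lam l) j = cSum lam (l + j) := by
  rw [cSum_eq_sum_range n _ _ (by omega), cSum_eq_sum_range n _ _ (by omega)]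
  refine Finset.sum_congr rfl fun i _ => ?_
  rw [part_shift _ _ (by omega)]
  congr 1
  ring

theorem size_eq_sum_part {n : ℕ} (lam : Fin n → ℕ) : size lam = ∑ i ∈ range n, part lam (i + 1) := by
  rw [size, ← Fin.sum_univ_eq_sum_range (fun i => part lam (i + 1))]
  refine Finset.sum_congr rfl fun i _ => ?_
  rw [part, dif_pos ⟨by omega, by omega⟩]
  congr 1

theorem size_eq_cSum_add {n : ℕ} (lam : Fin n → ℕ) : size lam = cSum lam 0 + cSum lam 1 := by
  have h : ∀ d l, n ≤ l + d → cSum lam l + cSum lam (l + 1) = ∑ i ∈ range d, part lam (l + i + 1) := by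
    intro d
    induction d with
    | zero =>
      intro l h
      rw [cSum_eq_zero _ (by omega), cSum_eq_zero _ (by omega)]
      rfl
    | succ d ih =>
      intro l h
      have := ih (l + 1) (by omega)
      rw [Finset.sum_range_succ', cSum_eq_add lam l]
      have e : ∀ i, l + (i + 1) + 1 = l + 1 + i + 1 := fun i => by ring
      simp only [e, ← this, add_zero]
      ring
  rw [size_eq_sum_part, h n 0 (by omega)]
  simp

theorem size_shift {n : ℕ} (lam : Fin n → ℕ) (l : ℕ) :
    size (shift lam l) = cSum lam l + cSum lam (l + 1) := by
  rw [size_eq_cSum_add, cSum_shift, cSum_shift, add_zero]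

theorem symmUnimodal_pairCount_part {n M : ℕ} {lam : Fin n → ℕ} (hlam : Antitone lam) (l : ℕ)
    (hM : n ≤ 2 * M + l) :
    SymmUnimodal (pairCount M fun i => part lam (i + l)) (cSum lam l + cSum lam (l + 1)) := by
  rw [cSum_succ_eq_sum_range lam l hM, cSum_eq_sum_range M lam l hM]
  push_cast
  exact symmUnimodal_pairCount M fun i j h1 h2 => part_antitone hlam (by omega) (by omega)

theorem pairCount_part_cSum_succ {n M : ℕ} {lam : Fin n → ℕ} (hlam : Antitone lam) (l : ℕ)
    (hM : n ≤ 2 * M + l) : pairCount M (fun i => part lam (i + l)) (cSum lam (l + 1)) = 1 := by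
  rw [cSum_succ_eq_sum_range lam l hM]
  push_cast
  exact pairCount_low M fun i j h1 h2 => part_antitone hlam (by omega) (by omega)

theorem pairCount_part_cSum {n M : ℕ} {lam : Fin n → ℕ} (hlam : Antitone lam) (l : ℕ)
    (hM : n ≤ 2 * M + l) : pairCount M (fun i => part lam (i + l)) (cSum lam l) = 1 := by
  rw [← pairCount_part_cSum_succ hlam l hM, ← (symmUnimodal_pairCount_part hlam l hM).symm]
  congr 1
  ring

/-- Between the ends of J_ℓ the count is at least its value 1 at an end. -/
theorem pairCount_part_pos {n M : ℕ} {lam : Fin n → ℕ} (hlam : Antitone lam) (l : ℕ)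
    (hM : n ≤ 2 * M + l) {k : ℕ} (hk : k ∈ J lam l) :
    0 < pairCount M (fun i => part lam (i + l)) k := by
  obtain ⟨h1, h2⟩ := mem_Icc.1 hk
  have h1' : (cSum lam (l + 1) : ℤ) ≤ k := by exact_mod_cast h1
  have h2' : (k : ℤ) ≤ cSum lam l := by exact_mod_cast h2
  have h3 := symmUnimodal_pairCount_part hlam l hM (cSum lam (l + 1)) k (by
    rw [abs_le]
    rcases abs_cases (2 * (cSum lam (l + 1) : ℤ) - (cSum lam l + cSum lam (l + 1))) with h | h
    · constructor <;> linarith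
    · rw [h.1]
      constructor <;> linarith)
  rw [pairCount_part_cSum_succ hlam l hM] at h3
  exact h3

theorem pairCount_part_eq_zero {n M : ℕ} {lam : Fin n → ℕ} (hlam : Antitone lam) (l : ℕ)
    (hM : n ≤ 2 * M + l) {k : ℤ} (hk : k < cSum lam (l + 1) ∨ cSum lam l < k) :
    pairCount M (fun i => part lam (i + l)) k = 0 := by
  have h0 : ∀ k : ℤ, k < cSum lam (l + 1) → pairCount M (fun i => part lam (i + l)) k = 0 := by
    intro k hk
    apply pairCount_eq_zero_of_lt
    rw [cSum_succ_eq_sum_range lam l hM] at hk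
    exact_mod_cast hk
  rcases hk with hk | hk
  · exact h0 k hk
  · rw [← (symmUnimodal_pairCount_part hlam l hM).symm]
    exact h0 _ (by linarith)

/-! ### The recursive coefficients are tuple counts -/

theorem coeffC_of_le_two : ∀ {n : ℕ} (_ : n ≤ 2) (lam : Fin n → ℕ) (k : ℕ), coeffC n lam k = 1
  | 0, _, _, _ => by rw [coeffC]
  | 1, _, _, _ => by rw [coeffC]
  | 2, _, _, _ => by rw [coeffC]

theorem evSum_le_odSum {n : ℕ} {lam : Fin n → ℕ} (hlam : Antitone lam) :
    evSum lam ≤ odSum lam := cSum_succ_le hlam 0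

theorem coeffC_of_mem {n k : ℕ} {lam : Fin (n + 3) → ℕ} (h1 : evSum lam ≤ k) (h2 : k ≤ odSum lam) :
    coeffC (n + 3) lam k =
      ∑ i ∈ Icc (max (evSum lam) (k + part lam 2 - part lam 1))
          (min k (odSum lam - part lam 1 + part lam 2)), coeffC (n + 2) (shift lam 1) i := by
  rw [coeffC]
  simp only [if_pos h2]
  rw [if_neg (not_lt.2 h1)]

theorem coeffC_of_le_evSum {n k : ℕ} {lam : Fin (n + 3) → ℕ} (hlam : Antitone lam)
    (h : k ≤ evSum lam) : coeffC (n + 3) lam k = coeffC (n + 2) (shift lam 1) k := by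
  have h2 : k ≤ odSum lam := h.trans (evSum_le_odSum hlam)
  rcases h.lt_or_eq with h1 | rfl
  · rw [coeffC]
    simp only [if_pos h2]
    rw [if_pos h1]
  -- At k = ev the definition uses the sum, which has the single index i = ev.
  · rw [coeffC_of_mem le_rfl h2]
    have h12 : part lam 2 ≤ part lam 1 := part_antitone hlam le_rfl (by omega)
    have hod : odSum lam = part lam 1 + cSum lam 2 := cSum_eq_add lam 0
    have hev : evSum lam = part lam 2 + cSum lam 3 := cSum_eq_add lam 1
    have h32 : cSum lam 3 ≤ cSum lam 2 := cSum_succ_le hlam 2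
    rw [max_eq_left (by omega), min_eq_left (by omega), Icc_self, sum_singleton]

/-- Outside [ev, od] the definition replaces one of k and |λ| - k by the other, so symmetry is built
in and only the middle interval needs an argument. -/
theorem coeffC_symm_of {n k : ℕ} {lam : Fin (n + 3) → ℕ} (hlam : Antitone lam) (hk : k ≤ size lam)
    (h : evSum lam ≤ k → k ≤ odSum lam →
      coeffC (n + 3) lam (size lam - k) = coeffC (n + 3) lam k) :
    coeffC (n + 3) lam (size lam - k) = coeffC (n + 3) lam k := by
  have hs : size lam = odSum lam + evSum lam := size_eq_cSum_add lam
  have hle := evSum_le_odSum hlam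
  by_cases h1 : evSum lam ≤ k ∧ k ≤ odSum lam
  · exact h h1.1 h1.2
  · have e : (if size lam - k ≤ odSum lam then size lam - k else size lam - (size lam - k)) =
        if k ≤ odSum lam then k else size lam - k := by split_ifs <;> omega
    rw [coeffC, coeffC]
    simp only [e]

/-- The two claims are proved together: the count for λ uses the symmetry for λ' and the count for
λ'', and the symmetry for λ follows from its count. -/
theorem coeffC_eq_pairCount_and_symm (n : ℕ) : ∀ {lam : Fin n → ℕ}, Antitone lam →
    (1 ≤ n → ∀ k ∈ J lam 0, ∀ M, n ≤ 2 * M → coeffC n lam k = pairCount M (part lam) k) ∧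
    ∀ k ≤ size lam, coeffC n lam (size lam - k) = coeffC n lam k := by
  induction n using Nat.strong_induction_on with
  | _ n ih =>
  intro lam hlam
  rcases Nat.lt_or_ge 2 n with hn | hn
  swap
  · refine ⟨fun h1 k hk M hM => ?_, fun k _ => by rw [coeffC_of_le_two hn, coeffC_of_le_two hn]⟩
    obtain ⟨M, rfl⟩ : ∃ M', M = M' + 1 := ⟨M - 1, by omega⟩
    have hod : cSum lam 0 = part lam 1 + cSum lam 2 := cSum_eq_add lam 0
    have hev : cSum lam 1 = part lam 2 + cSum lam 3 := cSum_eq_add lam 1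
    rw [cSum_eq_zero lam (by omega : n ≤ 2)] at hod
    rw [cSum_eq_zero lam (by omega : n ≤ 3)] at hev
    have hk' := mem_Icc.1 hk
    rw [zero_add] at hk'
    rw [coeffC_of_le_two hn, pairCount, Finset.sum_eq_single k]
    · rw [pairCount_of_zero M fun i hi => part_zero_of_lt _ (by omega)]
      simp
    · intro t _ ht
      rw [pairCount_of_zero M fun i hi => part_zero_of_lt _ (by omega), if_neg (by omega)]
    · intro h
      exact absurd (mem_Icc.2 ⟨by omega, by omega⟩) h
  · obtain ⟨n, rfl⟩ : ∃ n', n = n' + 3 := ⟨n - 3, by omega⟩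
    have hod : cSum lam 0 = part lam 1 + cSum lam 2 := cSum_eq_add lam 0
    have hev : cSum lam 1 = part lam 2 + cSum lam 3 := cSum_eq_add lam 1
    have h12 : part lam 2 ≤ part lam 1 := part_antitone hlam le_rfl (by omega)
    have h32 : cSum lam 3 ≤ cSum lam 2 := cSum_succ_le hlam 2
    have h21 : cSum lam 2 ≤ cSum lam 1 := cSum_succ_le hlam 1
    let lam' : Fin (n + 2) → ℕ := shift lam 1
    let lam'' : Fin (n + 1) → ℕ := shift lam' 1
    have hlam' : Antitone lam' := antitone_shift hlam 1
    have hlam'' : Antitone lam'' := antitone_shift hlam' 1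
    have hc' : ∀ j, cSum lam' j = cSum lam (1 + j) := cSum_shift lam 1
    have hc'' : ∀ j, cSum lam'' j = cSum lam (2 + j) := fun j => by
      rw [show cSum lam'' j = cSum lam' (1 + j) from cSum_shift lam' 1 j, hc', ← add_assoc]
    have hsize' : size lam' = cSum lam 1 + cSum lam 2 := size_shift lam 1
    have hpart : ∀ i, 1 ≤ i → part lam'' i = part lam (i + 2) := fun i hi => by
      rw [show part lam'' i = part lam' (i + 1) from part_shift lam' 1 hi,
        show part lam' (i + 1) = part lam (i + 1 + 1) from part_shift lam 1 (by omega)]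
    have hstep' : ∀ i ≤ cSum lam 2, coeffC (n + 2) lam' i = coeffC (n + 1) lam'' i := by
      intro i hi
      rcases n with _ | n
      · rw [coeffC_of_le_two (by omega), coeffC_of_le_two (by omega)]
      · exact coeffC_of_le_evSum hlam' (by rwa [evSum, hc'])
    have hmain : ∀ k ∈ J lam 0, ∀ M, n + 3 ≤ 2 * M →
        coeffC (n + 3) lam k = pairCount M (part lam) k := by
      intro k hk M hM
      obtain ⟨M, rfl⟩ : ∃ M', M = M' + 1 := ⟨M - 1, by omega⟩
      obtain ⟨hk1, hk2⟩ := mem_Icc.1 hk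
      rw [zero_add] at hk1
      -- Reflect i to |λ'| - i ≤ c_2, pass from λ' to λ'', and reflect in |λ''| = c_2 + c_3. The
      -- result is i - λ_2, because |λ'| = c_1 + c_2 and c_1 = λ_2 + c_3.
      have hcoeff : ∀ i, cSum lam 1 ≤ i → i ≤ cSum lam 2 + part lam 2 →
          coeffC (n + 2) lam' i = pairCount M (fun i => part lam (i + 2)) (i - part lam 2) := by
        intro i hi1 hi2
        rw [← (ih (n + 2) (by omega) hlam').2 i (by omega), hstep' _ (by omega),
          (ih (n + 1) (by omega) hlam'').1 (by omega) (size lam' - i) (mem_Icc.2 ⟨by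
            rw [hc'']; change cSum lam 3 ≤ _; omega, by
            rw [hc'']; change _ ≤ cSum lam 2; omega⟩) M (by omega), pairCount_congr M hpart,
          ← (symmUnimodal_pairCount_part (M := M) hlam 2 (by omega)).symm, hsize']
        congr 1
        change (cSum lam 2 : ℤ) + cSum lam 3 - _ = _
        omega
      rw [coeffC_of_mem hk1 hk2, pairCount]
      unfold evSum odSum
      have hzero : ∀ t : ℕ, pairCount M (fun i => part lam (i + 2)) ((k : ℤ) - t) ≠ 0 →
          cSum lam 3 + t ≤ k ∧ k ≤ cSum lam 2 + t := by
        intro t ht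
        by_contra h
        refine ht (pairCount_part_eq_zero hlam 2 (by omega) ?_)
        change _ < (cSum lam 3 : ℤ) ∨ _
        omega
      -- The substitution is t = k + λ_2 - i. The limits `k` and k - λ_1 + λ_2 for i become λ_2 ≤ t
      -- ≤ λ_1; the limits ev and od - λ_1 + λ_2 cut out the support, so the remaining t contribute
      -- 0.
      refine Finset.sum_of_injOn (fun i => k + part lam 2 - i) ?_ ?_ ?_ ?_
      · intro i hi j hj hij
        have hi' := mem_Icc.1 (mem_coe.1 hi)
        have hj' := mem_Icc.1 (mem_coe.1 hj)
        simp only at hij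
        omega
      · intro i hi
        have hi' := mem_Icc.1 (mem_coe.1 hi)
        refine mem_coe.2 (mem_Icc.2 ?_)
        simp only
        omega
      · intro t ht hnot
        by_contra h
        have h' := hzero t h
        have ht' := mem_Icc.1 ht
        refine hnot ⟨k + part lam 2 - t, mem_coe.2 (mem_Icc.2 ?_), ?_⟩
        · omega
        · simp only
          omega
      · intro i hi
        have hi' := mem_Icc.1 hi
        change coeffC (n + 2) lam' i = _
        rw [hcoeff i (by omega) (by omega)]
        congr 1
        push_cast [show i ≤ k + part lam 2 by omega]
        ring
    refine ⟨fun _ => hmain, fun k hk => coeffC_symm_of hlam hk fun h1 h2 => ?_⟩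
    have hs : size lam = cSum lam 0 + cSum lam 1 := size_eq_cSum_add lam
    unfold evSum at h1
    unfold odSum at h2
    have hS : SymmUnimodal (pairCount (n + 3) (part lam)) _ :=
      symmUnimodal_pairCount_part (M := n + 3) hlam 0 (by omega)
    rw [hmain k (mem_Icc.2 ⟨h1, h2⟩) (n + 3) (by omega),
      hmain (size lam - k) (mem_Icc.2 ⟨by rw [zero_add]; omega, by omega⟩) (n + 3) (by omega),
      ← hS.symm]
    congr 1
    rw [zero_add]
    omega

theorem coeffC_symm {n : ℕ} {lam : Fin n → ℕ} (hlam : Antitone lam) {k : ℕ} (hk : k ≤ size lam) :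
    coeffC n lam (size lam - k) = coeffC n lam k :=
  (coeffC_eq_pairCount_and_symm n hlam).2 k hk

/-- For j < l the `evSum` of the j-th truncation is c_{j+1} ≥ c_l ≥ k, so parts can be removed one
at a time. -/
theorem coeffC_shift {n : ℕ} {lam : Fin n → ℕ} (hlam : Antitone lam) (l : ℕ) (hl : l ≤ n - 1)
    {k : ℕ} (hk : k ≤ cSum lam l) : coeffC n lam k = coeffC (n - l) (shift lam l) k := by
  induction l with
  | zero => rfl
  | succ l ih =>
    rw [ih (by omega) (hk.trans (cSum_succ_le hlam l))]
    have key : ∀ (m : ℕ) (mu : Fin m → ℕ), Antitone mu → 2 ≤ m → k ≤ evSum mu →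
        coeffC m mu k = coeffC (m - 1) (shift mu 1) k := by
      intro m mu hmu hm h
      rcases Nat.lt_or_ge 2 m with h3 | h3
      · obtain ⟨m, rfl⟩ : ∃ m', m = m' + 3 := ⟨m - 3, by omega⟩
        exact coeffC_of_le_evSum hmu h
      · rw [coeffC_of_le_two h3, coeffC_of_le_two (by omega)]
    rw [key _ _ (antitone_shift hlam l) (by omega) (by rwa [evSum, cSum_shift])]
    have : shift (shift lam l) 1 = shift lam (l + 1) := by
      funext i
      simp only [shift]
      congr 1
      rw [Fin.mk.injEq]
      exact (add_assoc _ _ _).trans (congrArg _ (add_comm _ _))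
    exact congrArg (fun f => coeffC (n - l - 1) f k) this

theorem J_shift {n : ℕ} (lam : Fin n → ℕ) (l : ℕ) : J lam l = J (shift lam l) 0 := by
  rw [J, J, cSum_shift, cSum_shift, add_zero, zero_add]

theorem coeffC_eq_pairCount {n : ℕ} (hn : 1 ≤ n) {lam : Fin n → ℕ} (hlam : Antitone lam) {l : ℕ}
    (hl : l ≤ n - 1) {k : ℕ} (hk : k ∈ J lam l) :
    coeffC n lam k = pairCount n (fun i => part lam (i + l)) k := by
  rw [coeffC_shift hlam l hl (mem_Icc.1 hk).2,
    (coeffC_eq_pairCount_and_symm _ (antitone_shift hlam l)).1 (by omega) k (J_shift lam l ▸ hk) n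
      (by omega), pairCount_congr n fun i hi => part_shift lam l hi]

/-! ### Highest terms of the counting polynomials -/

theorem colHeight_le {n : ℕ} (lam : Fin n → ℕ) (j : ℕ) : colHeight lam j ≤ n :=
  (Finset.card_filter_le _ _).trans (by simp)

theorem colHeight_antitone {n : ℕ} (lam : Fin n → ℕ) : Antitone (colHeight lam) := fun _ _ h =>
  Finset.card_le_card (Finset.monotone_filter_right _ fun _ _ h' => h.trans_lt h')

theorem le_colHeight_iff {n : ℕ} {lam : Fin n → ℕ} (hlam : Antitone lam) {i : ℕ} (hi : 1 ≤ i)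
    (j : ℕ) : i ≤ colHeight lam j ↔ j < part lam i := by
  rcases le_or_gt i n with h | h
  · have h1 := pos_iff_lt_card_support (t := fun a => lam a - j)
      (fun a b hab => Nat.sub_le_sub_right (hlam hab) j) ⟨i - 1, by omega⟩
    simp only [Nat.sub_pos_iff_lt] at h1
    rw [part, dif_pos ⟨hi, h⟩, h1, colHeight]
    omega
  · rw [part_zero_of_lt lam h]
    have := colHeight_le lam j
    omega

theorem rows_colHeight {n : ℕ} {lam : Fin n → ℕ} (hlam : Antitone lam) {i : ℕ} (hi : 1 ≤ i) :
    rows (size lam) (colHeight lam) i = part lam i := by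
  have hle : part lam i ≤ size lam := by
    rw [part]
    split_ifs
    · exact Finset.single_le_sum (f := lam) (fun _ _ => Nat.zero_le _) (mem_univ _)
    · exact Nat.zero_le _
  have : ({j ∈ range (size lam) | i ≤ colHeight lam j} : Finset ℕ) = range (part lam i) := by
    ext j
    rw [mem_filter, le_colHeight_iff hlam hi, mem_range, mem_range]
    omega
  rw [rows, this, card_range]

theorem sum_half_eq (l m : ℕ) :
    ∑ i ∈ Icc (l + 2) m, (i - l) / 2 = (m - l) / 2 * ((m - l + 1) / 2) := by
  induction m with
  | zero =>
    rw [Icc_eq_empty (by omega)]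
    simp
  | succ m ih =>
    rcases le_or_gt (l + 2) (m + 1) with h | h
    · rw [Finset.sum_Icc_succ_top h, ih]
      obtain ⟨x, rfl⟩ := Nat.exists_eq_add_of_le (show l ≤ m by omega)
      rw [show l + x - l = x by omega, show l + x + 1 - l = x + 1 by omega]
      rcases Nat.even_or_odd' x with ⟨y, rfl | rfl⟩
      · rw [show 2 * y / 2 = y by omega, show (2 * y + 1) / 2 = y by omega,
          show (2 * y + 1 + 1) / 2 = y + 1 by omega]
        ring
      · rw [show (2 * y + 1) / 2 = y by omega, show (2 * y + 1 + 1) / 2 = y + 1 by omega,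
          show (2 * y + 1 + 1 + 1) / 2 = y + 1 by omega]
        ring
    · rw [Icc_eq_empty (by omega), sum_empty, show (m + 1 - l) / 2 = 0 by omega, zero_mul]

/-- Give each box of row i of the diagram the weight ⌊(i-l)/2⌋ and sum by rows or by columns. -/
theorem quarterSum_colHeight {n : ℕ} {lam : Fin n → ℕ} (hlam : Antitone lam) (l : ℕ) :
    quarterSum (size lam) (colHeight lam) l = aSum lam l := by
  have h : aSum lam l = ∑ i ∈ Icc (l + 2) n, ∑ j ∈ range (size lam),
      if i ≤ colHeight lam j then (i - l) / 2 else 0 := by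
    refine Finset.sum_congr rfl fun i hi => ?_
    rw [← rows_colHeight hlam (by have := (mem_Icc.1 hi).1; omega), rows, ← Finset.sum_filter,
      Finset.sum_const, smul_eq_mul, mul_comm]
  rw [h, Finset.sum_comm, quarterSum]
  refine Finset.sum_congr rfl fun j _ => ?_
  rw [← sum_half_eq, ← Finset.sum_filter]
  refine Finset.sum_congr ?_ fun _ _ => rfl
  have := colHeight_le lam j
  ext i
  simp only [mem_filter, mem_Icc]
  omega

/-- The bound holds for all l and k; whether it is attained depends on k lying in the support J_l of
the tuple count. -/
theorem countPoly_natDegree_le_and_coeff {n : ℕ} {lam : Fin n → ℕ} (hlam : Antitone lam)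
    (l k : ℕ) :
    (countPoly lam k).natDegree ≤ l * k + aSum lam l ∧
      (countPoly lam k).coeff (l * k + aSum lam l) =
        pairCount n (fun i => part lam (i + l)) k := by
  have h := subPoly_natDegree_le_and_coeff (M := n) (l := l) (size lam) (colHeight lam)
    (colHeight_antitone lam) (by have := colHeight_le lam 0; omega) k
  rw [quarterSum_colHeight hlam] at h
  refine ⟨natDegree_sum_le_of_forall_le _ _ fun r _ => (h r).1, ?_⟩
  rw [countPoly, finsetSum_coeff, Finset.sum_congr rfl fun r _ => (h r).2, ← Nat.cast_sum,
    pairCount_congr n (f := fun i => part lam (i + l))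
      (g := fun i => rows (size lam) (colHeight lam) (i + l))
      fun i _ => (rows_colHeight hlam (by omega)).symm, ← card_filter_rowBox]
  congr 1
  rw [Finset.card_eq_sum_card_fiberwise (f := fun t : Fin n → ℕ => #{i | 0 < t i})
    (t := range (n + 1))]
  · refine Finset.sum_congr rfl fun r _ => ?_
    rw [boxCount, Finset.filter_filter]
    congr 1
    refine Finset.filter_congr fun t _ => ?_
    rw [← Nat.cast_sum, Nat.cast_inj]
  · intro t _
    refine mem_coe.2 (mem_range.2 (Nat.lt_succ_of_le ((Finset.card_filter_le _ _).trans ?_)))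
    simp

theorem countPoly_natDegree_and_leadingCoeff {n : ℕ} (hn : 1 ≤ n) {lam : Fin n → ℕ}
    (hlam : Antitone lam) {l k : ℕ} (hl : l ≤ n - 1) (hk : k ∈ J lam l) :
    (countPoly lam k).natDegree = l * k + aSum lam l ∧
      (countPoly lam k).leadingCoeff = coeffC n lam k := by
  obtain ⟨h1, h2⟩ := countPoly_natDegree_le_and_coeff hlam l k
  have hpos := pairCount_part_pos (M := n) hlam l (by omega) hk
  have hd : (countPoly lam k).natDegree = l * k + aSum lam l := by
    refine le_antisymm h1 (le_natDegree_of_ne_zero ?_)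
    rw [h2]
    exact_mod_cast hpos.ne'
  refine ⟨hd, ?_⟩
  rw [leadingCoeff, hd, h2, coeffC_eq_pairCount hn hlam hl hk]

theorem highestTerm_countPoly {n : ℕ} (hn : 1 ≤ n) {lam : Fin n → ℕ}
    (hlam : Antitone lam) {l k : ℕ} (hl : l ≤ n - 1) (hk : k ∈ J lam l) :
    highestTerm (countPoly lam k) = monomial (l * k + aSum lam l) (coeffC n lam k : ℤ) := by
  obtain ⟨h1, h2⟩ := countPoly_natDegree_and_leadingCoeff hn hlam hl hk
  rw [highestTerm, h1, h2]

theorem SymmUnimodal.unimodalOn {f : ℤ → ℕ} {a b : ℕ} (h : SymmUnimodal f (b + a)) (hab : a ≤ b) :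
    UnimodalOn (fun k => f k) a b := by
  -- Rounding the midpoint down is harmless: when a + b is odd, the two central values agree.
  refine ⟨(a + b) / 2, ⟨by omega, by omega⟩, ?_, ?_⟩
  · intro x hx y hy hxy
    obtain ⟨hx1, hx2⟩ := hx
    obtain ⟨hy1, hy2⟩ := hy
    refine h _ _ ?_
    rw [abs_of_nonpos (by omega), abs_of_nonpos (by omega)]
    omega
  · intro x hx y hy hxy
    obtain ⟨hx1, hx2⟩ := hx
    obtain ⟨hy1, hy2⟩ := hy
    refine h _ _ ?_
    rw [abs_le]
    rcases abs_cases (2 * (y : ℤ) - (b + a)) with h' | h' <;> constructor <;> omega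

/-! ### The theorem -/

theorem mainTheorem3 (n : ℕ) (hn : 1 ≤ n) (lam : Fin n → ℕ) (hanti : Antitone lam)
    (hpos : ∀ i, 0 < lam i) :
    -- the counts of subgroups are polynomials in `p`, with the asserted highest terms
    (∃ N : ℕ → ℤ[X],
      (∀ k p : ℕ, p.Prime → (N k).eval (p : ℤ) = (subgroupCount p lam k : ℤ)) ∧
      (∀ l k : ℕ, l ≤ n - 1 → k ∈ J lam l →
        highestTerm (N k) = monomial (l * k + aSum lam l) (coeffC n lam k : ℤ)) ∧
      (∀ k : ℕ, size lam ≤ 2 * k → k ≤ size lam →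
        highestTerm (N k) = highestTerm (N (size lam - k))) ∧
      (∀ l k : ℕ, 1 ≤ l → l ≤ n - 1 → k ∈ JNeg lam l →
        highestTerm (N k) =
          monomial (l * (size lam - k) + aSum lam l) (coeffC n lam (size lam - k) : ℤ)) ∧
      IsGreatest {d : ℕ | ∃ k ≤ size lam, d = (N k).natDegree} (aSum lam 0)) ∧
    -- the recursion for the coefficients
    (n ≤ 2 → ∀ k ≤ size lam, coeffC n lam k = 1) ∧
    (∀ l : ℕ, 1 ≤ l → l ≤ n - 1 → J lam l = J (shift lam l) 0 ∧
      ∀ k ∈ J lam l, coeffC n lam k = coeffC (n - l) (shift lam l) k) ∧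
    (2 ≤ n → ∀ k ∈ J lam 0,
      coeffC n lam k =
        ∑ i ∈ Icc (max (evSum lam) (k + part lam 2 - part lam 1))
            (min k (odSum lam - part lam 1 + part lam 2)),
          coeffC (n - 1) (shift lam 1) i) ∧
    (∀ k ≤ size lam, coeffC n lam (size lam - k) = coeffC n lam k) ∧
    -- unimodality, symmetry and the values at the endpoints
    (∀ l : ℕ, l ≤ n - 1 →
      UnimodalOn (coeffC n lam) (cSum lam (l + 1)) (cSum lam l) ∧
      (∀ k ∈ J lam l, size (shift lam l) - k ∈ J lam l ∧
        coeffC n lam (size (shift lam l) - k) = coeffC n lam k)) ∧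
    (∀ l : ℕ, l ≤ n → coeffC n lam (cSum lam l) = 1) ∧
    -- the value of the maximal degree
    aSum lam 0 = ∑ i ∈ Icc 2 n, i / 2 * part lam i := by

  have hsize : size lam = cSum lam 0 + cSum lam 1 := size_eq_cSum_add lam
  have hanti_c : Antitone (cSum lam) := antitone_nat_of_succ_le (cSum_succ_le hanti)
  have hmemJ : ∀ l k, k ∈ JNeg lam l → 1 ≤ l → size lam - k ∈ J lam l := by
    intro l k hk hl
    have h1 := hanti_c (Nat.zero_le l)
    have h2 := hanti_c (Nat.zero_le (l + 1))
    have h3 := mem_Icc.1 hk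
    exact mem_Icc.2 ⟨by omega, by omega⟩
  refine ⟨⟨countPoly lam, ?_, ?_, ?_, ?_, ?_⟩, ?_, ?_, ?_, ?_, ?_, ?_, ?_⟩
  · intro k p hp
    have : Fact p.Prime := ⟨hp⟩
    exact eval_countPoly lam p k
  · exact fun l k hl hk => highestTerm_countPoly hn hanti hl hk
  · intro k _ hk
    rw [countPoly_symm lam hk]
  · intro l k h1 hl hk
    have hk' : k ≤ size lam := (mem_Icc.1 hk).2.trans (Nat.sub_le _ _)
    rw [← countPoly_symm lam hk']
    exact highestTerm_countPoly hn hanti hl (hmemJ l k hk h1)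
  -- The bound with ℓ = 0 does not involve k, and it is attained at k = ev, an end of J_0.
  · constructor
    · have hev : cSum lam 1 ∈ J lam 0 := mem_Icc.2 ⟨le_rfl, cSum_succ_le hanti 0⟩
      refine ⟨cSum lam 1, by omega, ?_⟩
      rw [(countPoly_natDegree_and_leadingCoeff hn hanti (Nat.zero_le _) hev).1]
      simp
    · rintro d ⟨k, -, rfl⟩
      simpa using (countPoly_natDegree_le_and_coeff hanti 0 k).1
  · exact fun hn2 k _ => coeffC_of_le_two hn2 lam k
  · exact fun l _ hl => ⟨J_shift lam l, fun k hk => coeffC_shift hanti l hl (mem_Icc.1 hk).2⟩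
  · intro hn2 k hk
    obtain ⟨hk1, hk2⟩ := mem_Icc.1 hk
    rcases Nat.lt_or_ge 2 n with h3 | h3
    · obtain ⟨n, rfl⟩ : ∃ n', n = n' + 3 := ⟨n - 3, by omega⟩
      exact coeffC_of_mem hk1 hk2
    · have hod : odSum lam = part lam 1 + cSum lam 2 := cSum_eq_add lam 0
      have hev : evSum lam = part lam 2 + cSum lam 3 := cSum_eq_add lam 1
      rw [cSum_eq_zero lam (by omega)] at hod hev
      have hk1' : evSum lam ≤ k := hk1
      have hk2' : k ≤ odSum lam := hk2
      rw [max_eq_left (by omega), show min k (odSum lam - part lam 1 + part lam 2) = evSum lam by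
        omega, Icc_self, sum_singleton, coeffC_of_le_two h3, coeffC_of_le_two (by omega)]
  · exact fun k hk => coeffC_symm hanti hk
  · intro l hl
    have hS := symmUnimodal_pairCount_part (M := n) hanti l (by omega)
    have hC : ∀ k ∈ J lam l, coeffC n lam k = pairCount n (fun i => part lam (i + l)) k :=
      fun k hk => coeffC_eq_pairCount hn hanti hl hk
    refine ⟨?_, fun k hk => ?_⟩
    · obtain ⟨m, hm, h1, h2⟩ := hS.unimodalOn (cSum_succ_le hanti l)
      refine ⟨m, hm, h1.congr fun k hk => ?_, h2.congr fun k hk => ?_⟩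
      · exact (hC k (mem_Icc.2 ⟨hk.1, hk.2.trans hm.2⟩)).symm
      · exact (hC k (mem_Icc.2 ⟨hm.1.trans hk.1, hk.2⟩)).symm
    · have hk' := mem_Icc.1 hk
      have hmem : size (shift lam l) - k ∈ J lam l := by
        rw [size_shift]
        exact mem_Icc.2 ⟨by omega, by omega⟩
      refine ⟨hmem, ?_⟩
      rw [hC k hk, hC _ hmem, ← hS.symm k, size_shift]
      congr 1
      omega
  · intro l hl
    -- For ℓ < n, c_ℓ is the right end of J_ℓ; c_n = 0 is the left end of J_{n-1}.
    rcases Nat.lt_or_ge l n with h | h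
    · rw [coeffC_eq_pairCount hn hanti (l := l) (by omega)
        (mem_Icc.2 ⟨cSum_succ_le hanti l, le_rfl⟩), pairCount_part_cSum hanti l (by omega)]
    · obtain rfl : l = n := by omega
      obtain ⟨l, rfl⟩ : ∃ l', l = l' + 1 := ⟨l - 1, by omega⟩
      rw [coeffC_eq_pairCount hn hanti (l := l) (by omega)
        (mem_Icc.2 ⟨le_rfl, cSum_succ_le hanti l⟩), pairCount_part_cSum_succ hanti l (by omega)]
  · simp [aSum]
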